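/- For $n\ge 1$ let $\mathbf s=(s_1,\dots,s_n):\mathbb C^n\to\mathbb C^n$, where $s_i$ is the $i$-th elementary symmetric function, $\Gamma_n=\mathbf s(\overline{\mathbb D}^n)$ and $b\Gamma_n=\mathbf s(\mathbb T^n)$. All operators are bounded linear operators on complex Hilbert spaces, and $\sigma$ denotes the Taylor joint spectrum of a commuting tuple. A commuting $n$-tuple $(S_1,\dots,S_n)$ on a Hilbert space $\mathcal H$ is called - a $\Gamma_n$-contraction if $\Gamma_n$ is a spectral set for it, i.e. $\sigma(S_1,\dots,S_n)\subseteq\Gamma_n$ and the holomorphic functional calculus $\mathcal O(\Gamma_n)\to\mathcal B(\mathcal H)$, $f\mapsto f(S_1,\dots,S_n)$ (the unique unital algebra homomorphism that sends the $i$-th coordinate function to $S_i$ and is continuous for locally uniform convergence on each open neighbourhood of $\Gamma_n$) satisfies $\|f(S_1,\dots,S_n)\|\le\sup_{\Gamma_n}|f|$ for every $f$ holomorphic in a neighbourhood of $\Gamma_n$; - a $\Gamma_n$-unitary if $S_1,\dots,S_n$ are normal and $\sigma(S_1,\dots,S_n)\subseteq b\Gamma_n$; - a $\Gamma_n$-isometry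 if there are a Hilbert space $\mathcal K\supseteq\mathcal H$ and a $\Gamma_n$-unitary $(N_1,\dots,N_n)$ on $\mathcal K$ such that $\mathcal H$ is invariant under each $N_i$ and $S_i=N_i|_{\mathcal H}$. A $\Gamma_n$-isometric dilation of $(S_1,\dots,S_n)$ is a $\Gamma_n$-isometry $(V_1,\dots,V_n)$ on a Hilbert space $\mathcal K\supseteq\mathcal H$ such that $P_{\mathcal H}V_1^{m_1}\cdots V_n^{m_n}|_{\mathcal H}=S_1^{m_1}\cdots S_n^{m_n}$ for all integers $m_1,\dots,m_n\ge0$, where $P_{\mathcal H}$ is the orthogonal projection of $\mathcal K$ onto $\mathcal H$. Theorem. Let $T_1,T_2,V_3$ be pairwise commuting operators on a complex Hilbert space $\mathcal H$ such that $\|T_1\|\le1$, $\|T_2\|\le1$ and $V_3$ is an isometry. Then the triple $$\left(\frac{T_1+T_2+V_3}{3},\ \frac{T_1T_2+T_2V_3+V_3T_1}{3},\ T_1T_2V_3\right)$$ is a $\Gamma_3$-contraction, and it has a $\Gamma_3$-isometric dilation. -/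

import Mathlib

open Filter Topology

universe u

/-! ### The symmetrized polydisc -/

/-- The symmetrization map `s : ℂⁿ → ℂⁿ`, whose components are the elementary symmetric functions
`s_1, …, s_n` (the index `i : Fin n` carries `s_{i+1}`). -/
def symmetrization (n : ℕ) (z : Fin n → ℂ) (i : Fin n) : ℂ :=
  ∑ t ∈ Finset.powersetCard ((i : ℕ) + 1) (Finset.univ : Finset (Fin n)), ∏ k ∈ t, z k

/-- The closed symmetrized polydisc `Γ_n`, the image under `s` of the closed unit polydisc. -/
def closedSymmPolydisc (n : ℕ) : Set (Fin n → ℂ) :=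
  symmetrization n '' {z | ∀ k, ‖z k‖ ≤ 1}

/-- The distinguished boundary `bΓ_n`, the image under `s` of the `n`-torus. -/
def symmPolydiscBoundary (n : ℕ) : Set (Fin n → ℂ) :=
  symmetrization n '' {z | ∀ k, ‖z k‖ = 1}

section Operators

variable {n : ℕ} {H : Type u} [NormedAddCommGroup H] [InnerProductSpace ℂ H]

/-! ### The Taylor joint spectrum -/

/-- The differential of the Koszul cochain complex of a tuple `A` of operators on `H`.
An element `∑_I x_I ⊗ e_I` of `H ⊗ Λ(ℂⁿ)` is the family `I ↦ x_I` indexed by the subsets of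
`{0, …, n-1}`, and the differential is `x ⊗ e_J ↦ ∑_i A_i x ⊗ (e_i ∧ e_J)`. -/
def koszulDifferential (A : Fin n → (H →L[ℂ] H)) (x : Finset (Fin n) → H)
    (I : Finset (Fin n)) : H :=
  ∑ i ∈ I, (-1 : ℂ) ^ (I.filter (fun j => j < i)).card • A i (x (I.erase i))

/-- The Taylor joint spectrum of a commuting tuple: the points `w` at which the Koszul complex
of `(T_1 - w_1, …, T_n - w_n)` is not exact. (The differential is homogeneous of degree one, so
exactness in every degree is exactness of the total complex.) -/
def taylorSpectrum (T : Fin n → (H →L[ℂ] H)) : Set (Fin n → ℂ) :=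
  {w | ¬ ∀ x : Finset (Fin n) → H,
      koszulDifferential (fun i => T i - w i • ContinuousLinearMap.id ℂ H) x = 0 →
      ∃ y, koszulDifferential (fun i => T i - w i • ContinuousLinearMap.id ℂ H) y = x}

/-! ### Holomorphic functional calculus and spectral sets -/

/-- The algebra `O(Ω)` of functions that are holomorphic on some neighbourhood of `Ω`
(analyticity at every point of `Ω` is analyticity on an open set containing `Ω`). -/
def holomorphicNear (Ω : Set (Fin n → ℂ)) : Subalgebra ℂ ((Fin n → ℂ) → ℂ) where
  carrier := {f | AnalyticOnNhd ℂ f Ω}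
  mul_mem' hf hg := hf.mul hg
  add_mem' hf hg := hf.add hg
  algebraMap_mem' _ := analyticOnNhd_const

/-- The `i`-th coordinate function, as an element of `O(Ω)`. -/
def coordNear (Ω : Set (Fin n → ℂ)) (i : Fin n) : holomorphicNear Ω :=
  ⟨fun z => z i, (ContinuousLinearMap.proj (R := ℂ) (φ := fun _ : Fin n => ℂ) i).analyticOnNhd Ω⟩

/-- `ρ : O(Ω) → B(H)` is a holomorphic functional calculus for `T` on `Ω`: a unital algebra
homomorphism that sends the coordinate functions to `T_1, …, T_n` and that is continuous for
locally uniform convergence on each open neighbourhood of `Ω`. (Continuity contains the fact that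
`ρ f` depends only on the values of `f` near `Ω`.) -/
structure IsHolomorphicCalculus (Ω : Set (Fin n → ℂ)) (T : Fin n → (H →L[ℂ] H))
    (ρ : holomorphicNear Ω →ₐ[ℂ] (H →L[ℂ] H)) : Prop where
  map_coord : ∀ i, ρ (coordNear Ω i) = T i
  continuous : ∀ U : Set (Fin n → ℂ), IsOpen U → Ω ⊆ U →
    ∀ (F : ℕ → holomorphicNear Ω) (f : holomorphicNear Ω),
      (∀ k, AnalyticOnNhd ℂ (F k : (Fin n → ℂ) → ℂ) U) →
      TendstoLocallyUniformlyOn (fun k => (F k : (Fin n → ℂ) → ℂ)) f atTop U →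
      Tendsto (fun k => ρ (F k)) atTop (𝓝 (ρ f))

/-- The compact, polynomially convex set `Ω` is a spectral set for the tuple `T`: the operators
commute, the joint spectrum lies in `Ω`, and the holomorphic functional calculus `O(Ω) → B(H)` is
contractive for the supremum norm on `Ω`. For such `Ω` the functional calculus is determined by
the properties in `IsHolomorphicCalculus`; that it exists and is unique is part of the
definition, so that contractivity is a property of a well-determined map. -/
def IsSpectralSet (Ω : Set (Fin n → ℂ)) (T : Fin n → (H →L[ℂ] H)) : Prop :=
  (∀ i j, Commute (T i) (T j)) ∧
  taylorSpectrum T ⊆ Ω ∧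
  (∃! ρ, IsHolomorphicCalculus Ω T ρ) ∧
  ∀ ρ, IsHolomorphicCalculus Ω T ρ →
    ∀ f : holomorphicNear Ω,
      ‖ρ f‖ ≤ sSup ((fun z => ‖(f : (Fin n → ℂ) → ℂ) z‖) '' Ω)

/-- A `Γ_n`-contraction: a commuting `n`-tuple of operators for which `Γ_n` is a spectral set. -/
def IsGammaContraction (S : Fin n → (H →L[ℂ] H)) : Prop :=
  IsSpectralSet (closedSymmPolydisc n) S

/-- A `Γ_n`-unitary: a commuting tuple of normal operators with joint spectrum in `bΓ_n`. -/
def IsGammaUnitary [CompleteSpace H] (S : Fin n → (H →L[ℂ] H)) : Prop :=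
  (∀ i j, Commute (S i) (S j)) ∧ (∀ i, IsStarNormal (S i)) ∧
  taylorSpectrum S ⊆ symmPolydiscBoundary n

/-- A `Γ_n`-isometry: the restriction of a `Γ_n`-unitary to a common invariant subspace. The
inclusion of `H` in the larger Hilbert space `K` is the linear isometry `ι`. -/
def IsGammaIsometry (S : Fin n → (H →L[ℂ] H)) : Prop :=
  (∀ i j, Commute (S i) (S j)) ∧
  ∃ (K : Type u) (_ : NormedAddCommGroup K) (_ : InnerProductSpace ℂ K) (_ : CompleteSpace K)
    (N : Fin n → (K →L[ℂ] K)) (ι : H →ₗᵢ[ℂ] K),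
    IsGammaUnitary N ∧ ∀ i (h : H), N i (ι h) = ι (S i h)

/-- The monomial `S_1^{m_1} ⋯ S_n^{m_n}`. -/
def opMonomial (S : Fin n → (H →L[ℂ] H)) (m : Fin n → ℕ) : H →L[ℂ] H :=
  (List.ofFn fun i => S i ^ m i).prod

/-- `S` has a `Γ_n`-isometric dilation: there are a Hilbert space `K` containing `H` (through
`ι`) and a `Γ_n`-isometry `V` on `K` with `P_H V_1^{m_1} ⋯ V_n^{m_n} |_H = S_1^{m_1} ⋯ S_n^{m_n}`
for all exponents; the adjoint of `ι` is the orthogonal projection of `K` onto `H`. -/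
def HasGammaIsometricDilation [CompleteSpace H] (S : Fin n → (H →L[ℂ] H)) : Prop :=
  ∃ (K : Type u) (_ : NormedAddCommGroup K) (_ : InnerProductSpace ℂ K) (_ : CompleteSpace K)
    (V : Fin n → (K →L[ℂ] K)) (ι : H →ₗᵢ[ℂ] K),
    IsGammaIsometry V ∧
    ∀ m : Fin n → ℕ,
      (ContinuousLinearMap.adjoint ι.toContinuousLinearMap) ∘L (opMonomial V m) ∘L
        ι.toContinuousLinearMap = opMonomial S m

end Operators

/-! Three commuting contractions need not have a joint unitary dilation, but the triple (T₁, T₂, V₃)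
has one. The isometry V₃ extends to a unitary on a direct limit to which T₁ and T₂ extend as
commuting contractions. Andô's theorem, carried out equivariantly for that unitary
(`exists_isometric_dilation`), lifts T₁, T₂ to commuting isometries that commute with a unitary lift
of V₃. Extending the two isometries to unitaries in turn gives commuting unitaries u on K with p(T)
= J* p(u) J for every polynomial p (`exists_unitary_dilation`).

The map m = (s₁/3, s₂/3, s₃) sends the torus into bΓ₃. Indeed s₂ = s₃ · conj s₁ there, so the cubic
with coefficients m(z) is self-inversive, and |s₁/3| ≤ 1 forces its roots onto the circle
(`symmMean_mem_symmPolydiscBoundary`). Hence m(u), formed by the calculus π of u on C(𝕋³), is a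
Γ₃-unitary that dilates the given triple m(T).

For the spectral set property, f ↦ J* π(f ∘ m) J is linear and contractive on O(Γ₃) and agrees with
the polynomial calculus of m(T) on polynomials. Polynomials approximate O(Γ₃) near Γ₃
(`exists_polynomial_tendstoLocallyUniformlyOn`), so this map is multiplicative and is the only
holomorphic calculus. The Taylor spectrum is located by polynomial convexity. If |p(w)| > ‖p(S)‖,
then p(S) - p(w) is invertible and lies in the ideal generated by the S_i - w_i, which makes the
Koszul complex at w exact. -/

/-! ### Exactness of the Koszul complex. -/

section Koszul

variable {n : ℕ} {H : Type u} [NormedAddCommGroup H] [InnerProductSpace ℂ H]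

/-- If `∑ A_i B_i = 1` with each `B_k` commuting with each `A_i`, then the Koszul complex of `A`
is exact: contraction with `B` is a homotopy from the identity to zero. -/
theorem koszulDifferential_exact_of_sum_mul_eq_one {A B : Fin n → (H →L[ℂ] H)}
    (hAB : ∀ i k, Commute (A i) (B k)) (hone : ∑ i, A i * B i = 1)
    (x : Finset (Fin n) → H) (hx : koszulDifferential A x = 0) :
    ∃ y, koszulDifferential A y = x := by
  classical
  let ε : Fin n → Finset (Fin n) → ℂ := fun i I => (-1 : ℂ) ^ (I.filter (fun j => j < i)).card
  have hεsq : ∀ i I, ε i I * ε i I = 1 := fun i I => by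
    simp only [ε, ← pow_add]
    exact Even.neg_one_pow ⟨_, rfl⟩
  have hcomm : ∀ i k h, A i (B k h) = B k (A i h) := fun i k h => by
    simpa using congrArg (fun T : H →L[ℂ] H => T h) (hAB i k).eq
  have hε_erase : ∀ i I, ε i (I.erase i) = ε i I := fun i I => by
    simp only [ε]
    congr 2
    ext j
    simp only [Finset.mem_filter, Finset.mem_erase]
    grind
  have hε_insert_self : ∀ i I, ε i (insert i I) = ε i I := fun i I => by
    simp only [ε]
    congr 2
    ext j
    simp only [Finset.mem_filter, Finset.mem_insert]
    grind
  have hε_erase_ne : ∀ i k I, i ∈ I → ε k I = ε k (I.erase i) * (if i < k then -1 else 1) := by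
    intro i k I hi
    simp only [ε, Finset.filter_erase]
    split_ifs with hik
    · rw [← pow_succ, Finset.card_erase_add_one (by simp [hi, hik])]
    · rw [Finset.erase_eq_of_notMem (by simp [hik]), mul_one]
  have hε_insert_ne : ∀ i k I, k ∉ I →
      ε i (insert k I) = ε i I * (if k < i then -1 else 1) := by
    intro i k I hk
    simp only [ε, Finset.filter_insert]
    split_ifs with hki
    · rw [Finset.card_insert_of_notMem (by simp [hk]), pow_succ]
    · rw [mul_one]
  -- For i ≠ k, exterior multiplication by e_i anticommutes with contraction by e_k.
  have hsign : ∀ i k I, i ∈ I → k ∉ I →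
      ε i I * ε k (I.erase i) = -(ε k I * ε i (insert k I)) := by
    intro i k I hi hk
    rw [hε_erase_ne i k I hi, hε_insert_ne i k I hk]
    rcases lt_trichotomy i k with h | h | h
    · simp [h, h.not_gt]; ring
    · exact absurd (h ▸ hi) hk
    · simp [h, h.not_gt]; ring
  have hx' : ∀ I, ∑ i ∈ I, ε i I • A i (x (I.erase i)) = 0 := fun I => congrFun hx I
  refine ⟨fun I => ∑ k ∈ Iᶜ, ε k I • B k (x (insert k I)), ?_⟩
  funext I
  -- Closedness of x at I ∪ {k} expresses A_k x(I) through the other terms. The cross terms of `hin`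
  -- thus become the A_k B_k x(I) with k ∉ I, which complete the sum ∑ A_i B_i = 1.
  have hout : ∀ k ∈ Iᶜ, A k (B k (x I)) =
      ∑ i ∈ I, (ε i I * ε k (I.erase i)) • A i (B k (x (insert k (I.erase i)))) := by
    intro k hk
    have hk : k ∉ I := by simpa using hk
    have h := hx' (insert k I)
    rw [Finset.sum_insert hk, Finset.erase_insert hk, hε_insert_self] at h
    have h2 := congrArg (fun v => ε k I • B k v) h
    simp only [map_add, map_smul, map_sum, smul_add, smul_zero, map_zero, smul_smul, hεsq,
      one_smul, Finset.smul_sum] at h2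
    rw [hcomm, eq_neg_of_add_eq_zero_left h2, ← Finset.sum_neg_distrib]
    refine Finset.sum_congr rfl fun i hi => ?_
    rw [hsign i k I hi hk, neg_smul, hcomm, Finset.erase_insert_of_ne]
    rintro rfl
    exact hk hi
  have hin : ∀ i ∈ I, ε i I • A i (∑ k ∈ (I.erase i)ᶜ,
      ε k (I.erase i) • B k (x (insert k (I.erase i)))) =
      A i (B i (x I)) + ∑ k ∈ Iᶜ, (ε i I * ε k (I.erase i)) •
        A i (B k (x (insert k (I.erase i)))) := by
    intro i hi
    have : (I.erase i)ᶜ = insert i Iᶜ := by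
      ext j; simp only [Finset.mem_compl, Finset.mem_erase, Finset.mem_insert]; grind
    rw [this, Finset.sum_insert (by simpa using hi), Finset.insert_erase hi, hε_erase]
    simp only [map_add, map_smul, map_sum, smul_add, smul_smul, hεsq, one_smul, Finset.smul_sum]
  change ∑ i ∈ I, ε i I • A i (∑ k ∈ (I.erase i)ᶜ,
      ε k (I.erase i) • B k (x (insert k (I.erase i)))) = x I
  rw [Finset.sum_congr rfl hin, Finset.sum_add_distrib, Finset.sum_comm,
    ← Finset.sum_congr rfl hout, Finset.sum_add_sum_compl]
  simpa using congrArg (fun T : H →L[ℂ] H => T (x I)) hone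

/-- A point `w` is off the Taylor spectrum of `T` if `∑ (T_i - w_i) B_i = 1` is solvable by
operators `B_k` that commute with the `T_i`. -/
theorem notMem_taylorSpectrum_of_sum_mul_eq_one {T B : Fin n → (H →L[ℂ] H)} {w : Fin n → ℂ}
    (hTB : ∀ i k, Commute (T i) (B k))
    (hone : ∑ i, (T i - w i • ContinuousLinearMap.id ℂ H) * B i = 1) :
    w ∉ taylorSpectrum T := by
  simp only [taylorSpectrum, Set.mem_ofPred_eq, not_not]
  refine koszulDifferential_exact_of_sum_mul_eq_one (B := B) (fun i k => ?_) hone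
  exact (hTB i k).sub_left ((Commute.one_left (B k)).smul_left (w i))

end Koszul

/-! ### Polynomial calculus and exclusion of points from the Taylor spectrum. -/

section PolynomialCalculus

open MvPolynomial

open scoped IsMulCommutative in
/-- A commuting tuple in an algebra has a polynomial calculus. -/
theorem exists_mvPolynomial_algHom {n : ℕ} {R A : Type*} [CommRing R] [Ring A] [Algebra R A]
    (a : Fin n → A) (ha : ∀ i j, Commute (a i) (a j)) :
    ∃ Φ : MvPolynomial (Fin n) R →ₐ[R] A, ∀ i, Φ (X i) = a i := by
  -- `aeval` needs a commutative target, here the subalgebra generated by the tuple.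
  have := Algebra.isMulCommutative_adjoin R (s := Set.range a)
    (by rintro _ ⟨i, rfl⟩ _ ⟨j, rfl⟩; exact ha i j)
  refine ⟨(Algebra.adjoin R (Set.range a)).val.comp
    (aeval fun i => ⟨a i, Algebra.subset_adjoin ⟨i, rfl⟩⟩), fun i => ?_⟩
  simp

/-- The Taylor expansion to first order: `p - p(w)` lies in the ideal generated by the `X_i - w_i`. -/
theorem MvPolynomial.exists_sub_C_eval_eq_sum {n : ℕ} {R : Type*} [CommRing R] (w : Fin n → R)
    (p : MvPolynomial (Fin n) R) :
    ∃ q : Fin n → MvPolynomial (Fin n) R, p - C (eval w p) = ∑ i, (X i - C (w i)) * q i := by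
  induction p using MvPolynomial.induction_on with
  | C a => exact ⟨0, by simp⟩
  | add p q hp hq =>
    obtain ⟨p', hp⟩ := hp
    obtain ⟨q', hq⟩ := hq
    refine ⟨p' + q', ?_⟩
    simp only [Pi.add_apply, mul_add, Finset.sum_add_distrib, ← hp, ← hq, map_add]
    ring
  | mul_X p i hp =>
    obtain ⟨p', hp⟩ := hp
    -- From p X_i - p(w) w_i = X_i (p - p(w)) + p(w) (X_i - w_i).
    refine ⟨fun j => X i * p' j + if j = i then C (eval w p) else 0, ?_⟩
    simp only [mul_add, Finset.sum_add_distrib, mul_ite, mul_zero, Finset.sum_ite_eq',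
      Finset.mem_univ, if_true, map_mul, eval_X]
    have : ∑ j, (X j - C (w j)) * (X i * p' j) = X i * ∑ j, (X j - C (w j)) * p' j := by
      rw [Finset.mul_sum]; exact Finset.sum_congr rfl fun j _ => by ring
    rw [this, ← hp]
    ring

theorem opMonomial_eq_map_prod {n : ℕ} {H : Type u} [NormedAddCommGroup H] [InnerProductSpace ℂ H]
    {S : Fin n → (H →L[ℂ] H)} {Φ : MvPolynomial (Fin n) ℂ →ₐ[ℂ] (H →L[ℂ] H)}
    (hΦ : ∀ i, Φ (X i) = S i) (m : Fin n → ℕ) :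
    opMonomial S m = Φ (List.ofFn fun i => X i ^ m i).prod := by
  simp [opMonomial, map_list_prod, List.map_ofFn, Function.comp_def, hΦ]

variable {n : ℕ} {H : Type u} [NormedAddCommGroup H] [InnerProductSpace ℂ H] [CompleteSpace H]

/-- If some polynomial takes the value `1` at `w` and a norm `< 1` at the operators, then `w` is
off the Taylor spectrum. -/
theorem notMem_taylorSpectrum_of_norm_lt {S : Fin n → (H →L[ℂ] H)}
    {Φ : MvPolynomial (Fin n) ℂ →ₐ[ℂ] (H →L[ℂ] H)} (hΦ : ∀ i, Φ (X i) = S i)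
    {w : Fin n → ℂ} {p : MvPolynomial (Fin n) ℂ} (hp : ‖Φ p‖ < ‖eval w p‖) :
    w ∉ taylorSpectrum S := by
  obtain ⟨q, hq⟩ := MvPolynomial.exists_sub_C_eval_eq_sum w p
  have hunit : IsUnit (Φ (p - C (eval w p))) := by
    -- Only ‖1‖ ≤ 1 is available, since ‖1‖ = 0 on the zero space.
    have hw : eval w p ∉ spectrum ℂ (Φ p) := fun h =>
      absurd ((spectrum.norm_le_norm_mul_of_mem h).trans
        (mul_le_of_le_one_right (norm_nonneg _) ContinuousLinearMap.norm_id_le)) (not_le.2 hp)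
    rw [spectrum.notMem_iff] at hw
    have : Φ (p - C (eval w p)) = -(algebraMap ℂ (H →L[ℂ] H) (eval w p) - Φ p) := by
      rw [map_sub, neg_sub]
      congr 1
      rw [← MvPolynomial.algebraMap_eq, AlgHom.commutes]
    rw [this]
    exact hw.neg
  obtain ⟨v, hv⟩ := hunit
  have hcomm : ∀ r, Commute (Φ r) ((v⁻¹ : (H →L[ℂ] H)ˣ) : H →L[ℂ] H) := fun r => by
    apply Commute.units_inv_right
    rw [hv]
    exact (Commute.all r _).map Φ
  refine notMem_taylorSpectrum_of_sum_mul_eq_one (B := fun i => Φ (q i) * (v⁻¹ : (H →L[ℂ] H)ˣ).val) (fun i k => ?_) ?_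
  · rw [← hΦ]
    exact ((Commute.all _ _).map Φ).mul_right (hcomm _)
  · have : ∀ i, S i - w i • ContinuousLinearMap.id ℂ H = Φ (X i - C (w i)) := fun i => by
      rw [map_sub, hΦ, ← MvPolynomial.algebraMap_eq, AlgHom.commutes, Algebra.algebraMap_eq_smul_one]
      rfl
    simp only [this, ← mul_assoc, ← map_mul, ← Finset.sum_mul, ← map_sum, ← hq, ← hv]
    exact v.mul_inv

omit [CompleteSpace H] in
/-- If `T_k - w_k` is invertible and commutes with the tuple, then `w` is off the Taylor spectrum. -/
theorem notMem_taylorSpectrum_of_notMem_spectrum {T : Fin n → (H →L[ℂ] H)}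
    (hT : ∀ i j, Commute (T i) (T j)) {w : Fin n → ℂ} {k : Fin n} (hk : w k ∉ spectrum ℂ (T k)) :
    w ∉ taylorSpectrum T := by
  rw [spectrum.notMem_iff] at hk
  obtain ⟨v, hv⟩ := hk.neg
  have hv' : (v : H →L[ℂ] H) = T k - w k • ContinuousLinearMap.id ℂ H := by
    rw [hv, neg_sub, Algebra.algebraMap_eq_smul_one]; rfl
  refine notMem_taylorSpectrum_of_sum_mul_eq_one
    (B := fun i => if i = k then (v⁻¹ : (H →L[ℂ] H)ˣ).val else 0) (fun i j => ?_) ?_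
  · split_ifs
    · apply Commute.units_inv_right
      rw [hv']
      exact (hT i k).sub_right ((Commute.one_right (T i)).smul_right (w k))
    · exact Commute.zero_right _
  · simp only [mul_ite, mul_zero, Finset.sum_ite_eq', Finset.mem_univ, if_true, ← hv']
    exact v.mul_inv

end PolynomialCalculus

/-! ### Continuous calculus of commuting unitaries on the torus. -/

section TorusCalculus

open WeakDual

/-- The `k`-th coordinate function on the torus. -/
noncomputable def torusCoord {n : ℕ} (k : Fin n) : C(Fin n → Circle, ℂ) :=
  ⟨fun z => (z k : ℂ), by fun_prop⟩

/-- Continuous functional calculus of a commuting tuple of unitaries in a commutative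
C⋆-algebra. -/
theorem exists_torus_starAlgHom_of_comm {n : ℕ} {A : Type*} [CommCStarAlgebra A] (u : Fin n → A)
    (hu : ∀ k, star (u k) * u k = 1) :
    ∃ π : C(Fin n → Circle, ℂ) →⋆ₐ[ℂ] A, ∀ k, π (torusCoord k) = u k := by
  have hnorm : ∀ (χ : characterSpace ℂ A) k, χ (u k) ∈ Submonoid.unitSphere ℂ := fun χ k => by
    have h := congrArg χ (hu k)
    rw [map_mul, map_star, map_one] at h
    have h2 := congrArg (fun z : ℂ => ‖z‖) h
    simp only [norm_mul, norm_star, norm_one] at h2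
    refine mem_sphere_zero_iff_norm.2 ?_
    nlinarith [norm_nonneg (χ (u k))]
  -- Characters send unitaries to the circle, so the tuple maps the character space into the torus.
  -- Pulling back along θ and inverting the Gelfand transform gives the calculus.
  let θ : C(characterSpace ℂ A, Fin n → Circle) :=
    ⟨fun χ k => ⟨χ (u k), hnorm χ k⟩, continuous_pi fun k =>
      ((gelfandStarTransform A (u k)).continuous).subtype_mk _⟩
  refine ⟨((gelfandStarTransform A).symm : _ →⋆ₐ[ℂ] A).comp (θ.compStarAlgHom' ℂ ℂ), fun k => ?_⟩
  change (gelfandStarTransform A).symm ((torusCoord k).comp θ) = u k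
  rw [← (gelfandStarTransform A).symm_apply_apply (u k)]
  congr 1

open scoped IsMulCommutative in
/-- Continuous functional calculus of a commuting tuple of unitaries in a C⋆-algebra. -/
theorem exists_torus_starAlgHom {n : ℕ} {A : Type*} [CStarAlgebra A] (u : Fin n → A)
    (hu : ∀ k, u k ∈ unitary A) (hcomm : ∀ i j, Commute (u i) (u j)) :
    ∃ π : C(Fin n → Circle, ℂ) →⋆ₐ[ℂ] A, ∀ k, π (torusCoord k) = u k := by
  have hstar : ∀ i j, Commute (u i) (star (u j)) := fun i j => by
    let v : Aˣ := Unitary.toUnits ⟨u j, hu j⟩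
    exact Commute.units_inv_right (u := v) (hcomm i j)
  let B : StarSubalgebra ℂ A := StarAlgebra.adjoin ℂ (Set.range u)
  have hB : IsMulCommutative B := StarAlgebra.isMulCommutative_adjoin ℂ
    (by rintro _ ⟨i, rfl⟩ _ ⟨j, rfl⟩; exact hcomm i j)
    (by rintro _ ⟨i, rfl⟩ _ ⟨j, rfl⟩; exact hstar i j)
  have hclosed : IsClosed (B.topologicalClosure : Set A) := B.isClosed_topologicalClosure
  let _ : CStarAlgebra B.topologicalClosure := StarSubalgebra.cstarAlgebra _
  let _ : CommCStarAlgebra B.topologicalClosure :=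
    { mul_comm := (B.commRingTopologicalClosure fun x y => mul_comm x y).mul_comm }
  have hmem : ∀ k, u k ∈ B.topologicalClosure := fun k =>
    B.le_topologicalClosure (StarAlgebra.subset_adjoin ℂ _ ⟨k, rfl⟩)
  obtain ⟨π, hπ⟩ := exists_torus_starAlgHom_of_comm (A := B.topologicalClosure)
    (fun k => ⟨u k, hmem k⟩) (fun k => Subtype.ext (Unitary.mem_iff.1 (hu k)).1)
  exact ⟨B.topologicalClosure.subtype.comp π, fun k => by
    simpa using congrArg Subtype.val (hπ k)⟩

end TorusCalculus

/-! ### Symmetric polynomials as polynomials in `symmetrization`. -/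

section Symmetrization

open MvPolynomial

theorem eval_esymm {n : ℕ} (z : Fin n → ℂ) (i : Fin n) :
    eval z (esymm (Fin n) ℂ (i + 1)) = symmetrization n z i := by
  simp [esymm, symmetrization]

theorem symmetrization_comp_perm {n : ℕ} (z : Fin n → ℂ) (σ : Equiv.Perm (Fin n)) :
    symmetrization n (z ∘ σ) = symmetrization n z := by
  funext i
  rw [← eval_esymm, ← eval_esymm, ← eval_rename, esymm_isSymmetric]

theorem continuous_symmetrization (n : ℕ) : Continuous (symmetrization n) := by
  unfold symmetrization
  fun_prop

theorem eval_aeval {σ τ R : Type*} [CommSemiring R] (z : τ → R) (f : σ → MvPolynomial τ R)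
    (P : MvPolynomial σ R) : eval z (aeval f P) = eval (fun i => eval z (f i)) P := by
  have h := comp_aeval_apply f (aeval (S₁ := R) z) P
  simp only [aeval_eq_eval] at h
  exact h

/-- A function of the form `z ↦ Q(z)` that is invariant under permutations of the coordinates is
a polynomial in the elementary symmetric functions. -/
theorem exists_eval_symmetrization_eq {n : ℕ} {Q : MvPolynomial (Fin n) ℂ}
    (hQ : ∀ (σ : Equiv.Perm (Fin n)) z, eval (z ∘ σ) Q = eval z Q) :
    ∃ P : MvPolynomial (Fin n) ℂ, ∀ z, eval (symmetrization n z) P = eval z Q := by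
  have hsym : Q ∈ symmetricSubalgebra (Fin n) ℂ := fun σ =>
    MvPolynomial.funext fun z => by rw [eval_rename, hQ]
  obtain ⟨P, hP⟩ := esymmAlgHom_surjective (σ := Fin n) ℂ (Fintype.card_fin n).le ⟨Q, hsym⟩
  refine ⟨P, fun z => ?_⟩
  have h : aeval (fun i : Fin n => esymm (Fin n) ℂ (i + 1)) P = Q := by
    rw [← esymmAlgHom_apply, hP]
  rw [← h, eval_aeval]
  simp only [eval_esymm]

theorem symmetrization_three (z : Fin 3 → ℂ) :
    symmetrization 3 z = ![z 0 + z 1 + z 2, z 0 * z 1 + z 0 * z 2 + z 1 * z 2, z 0 * z 1 * z 2] := by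
  have h1 : Finset.powersetCard 1 (Finset.univ : Finset (Fin 3)) = {{0}, {1}, {2}} := by decide
  have h2 : Finset.powersetCard 2 (Finset.univ : Finset (Fin 3)) = {{0, 1}, {0, 2}, {1, 2}} := by
    decide
  have h3 : Finset.powersetCard 3 (Finset.univ : Finset (Fin 3)) = {{0, 1, 2}} := by decide
  funext i
  fin_cases i
  · simp only [symmetrization, Fin.zero_eta, zero_add, h1]
    rw [Finset.sum_insert (by decide), Finset.sum_insert (by decide)]
    simp [add_assoc]
  · simp only [symmetrization, Fin.mk_one, Nat.reduceAdd, h2]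
    rw [Finset.sum_insert (by decide), Finset.sum_insert (by decide)]
    simp [add_assoc]
  · simp only [symmetrization, Fin.reduceFinMk, Nat.reduceAdd, h3]
    simp [mul_assoc]

end Symmetrization

/-! ### Roots of cubics and points of ℂ³. -/

section ComplexRoots

open Polynomial in
theorem exists_root_quadratic (b c : ℂ) : ∃ x : ℂ, x ^ 2 - b * x + c = 0 := by
  have hd : (X ^ 2 - C b * X + C c : ℂ[X]).degree = 2 := by compute_degree!
  obtain ⟨x, hx⟩ := IsAlgClosed.exists_root (X ^ 2 - C b * X + C c : ℂ[X]) (by simp [hd])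
  exact ⟨x, by simpa using hx⟩

open Polynomial in
theorem exists_root_cubic (b c d : ℂ) : ∃ x : ℂ, x ^ 3 - b * x ^ 2 + c * x - d = 0 := by
  have hd : (X ^ 3 - C b * X ^ 2 + C c * X - C d : ℂ[X]).degree = 3 := by compute_degree!
  obtain ⟨x, hx⟩ := IsAlgClosed.exists_root (X ^ 3 - C b * X ^ 2 + C c * X - C d : ℂ[X])
    (by simp [hd])
  exact ⟨x, by simpa using hx⟩

/-- A root a of the cubic with coefficients w is split off, and b is a root of the quotient
quadratic. The third root is then w₀ - a - b. -/
theorem symmetrization_three_surjective : Function.Surjective (symmetrization 3) := by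
  intro w
  obtain ⟨a, ha⟩ := exists_root_cubic (w 0) (w 1) (w 2)
  obtain ⟨b, hb⟩ := exists_root_quadratic (w 0 - a) (w 1 - a * (w 0 - a))
  refine ⟨![a, b, w 0 - a - b], ?_⟩
  rw [symmetrization_three]
  funext i
  fin_cases i <;> simp
  · linear_combination -hb
  · linear_combination ha - a * hb

/-- The coordinates of `a` are roots of the cubic with coefficients `s(a)`. -/
theorem cubic_symmetrization_eq_zero (a : Fin 3 → ℂ) (k : Fin 3) :
    a k ^ 3 - symmetrization 3 a 0 * a k ^ 2 + symmetrization 3 a 1 * a k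
      - symmetrization 3 a 2 = 0 := by
  rw [symmetrization_three]
  fin_cases k <;> simp <;> ring

theorem norm_symmetrization_three_le {z : Fin 3 → ℂ} (hz : ∀ k, ‖z k‖ ≤ 1) (j : Fin 3) :
    ‖symmetrization 3 z j‖ ≤ 3 := by
  have hm : ∀ i k, ‖z i * z k‖ ≤ 1 := fun i k => by
    rw [norm_mul]; exact mul_le_one₀ (hz i) (norm_nonneg _) (hz k)
  rw [symmetrization_three]
  fin_cases j
  · exact (norm_add₃_le).trans (by linarith [hz 0, hz 1, hz 2])
  · exact (norm_add₃_le).trans (by linarith [hm 0 1, hm 0 2, hm 1 2])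
  · change ‖z 0 * z 1 * z 2‖ ≤ 3
    rw [norm_mul]
    exact (mul_le_one₀ (hm 0 1) (norm_nonneg _) (hz 2)).trans (by norm_num)

/-- Cauchy's bound for the roots of a cubic whose coefficients are at most `3`. -/
theorem norm_lt_six_of_cubic_eq_zero {x b c d : ℂ} (hb : ‖b‖ ≤ 3) (hc : ‖c‖ ≤ 3) (hd : ‖d‖ ≤ 3)
    (hx : x ^ 3 - b * x ^ 2 + c * x - d = 0) : ‖x‖ < 6 := by
  have h : x ^ 3 = b * x ^ 2 - c * x + d := by linear_combination hx
  have h2 : ‖x‖ ^ 3 ≤ ‖b‖ * ‖x‖ ^ 2 + ‖c‖ * ‖x‖ + ‖d‖ := by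
    rw [← norm_pow, h]
    refine (norm_add_le _ _).trans ?_
    gcongr
    refine (norm_sub_le _ _).trans ?_
    simp
  -- For r ≥ 6 one has r³ ≥ 6r² > 3r² + 3r + 3. The value 6 is not sharp; any fixed bound would
  -- serve.
  by_contra! h6
  nlinarith [norm_nonneg x, sq_nonneg ‖x‖, mul_le_mul_of_nonneg_right hb (sq_nonneg ‖x‖),
    mul_le_mul_of_nonneg_right hc (norm_nonneg x), mul_le_mul_of_nonneg_right h6 (sq_nonneg ‖x‖)]

/-- A root of a self-inversive cubic `x³ - c x² + p c̄ x - p` with `|p| = 1`, `|c| ≤ 1` lies in the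
closed disc. -/
theorem norm_le_one_of_selfInversive_cubic {x c p : ℂ} (hp : ‖p‖ = 1) (hc : ‖c‖ ≤ 1)
    (hx : x ^ 3 - c * x ^ 2 + p * (starRingEnd ℂ) c * x - p = 0) : ‖x‖ ≤ 1 := by
  by_contra! h1
  have h : x ^ 2 * (x - c) = p * (1 - (starRingEnd ℂ) c * x) := by linear_combination hx
  have h2 : ‖x‖ ^ 2 * ‖x - c‖ = ‖1 - (starRingEnd ℂ) c * x‖ := by
    simpa [hp] using congrArg norm h
  -- The identity behind the Blaschke factor of c. For |x| > 1 it gives |1 - c̄x| ≤ |x - c|, against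
  -- |x|² |x - c| = |1 - c̄x|.
  have h3 : ‖1 - (starRingEnd ℂ) c * x‖ ^ 2 - ‖x - c‖ ^ 2 = (1 - ‖c‖ ^ 2) * (1 - ‖x‖ ^ 2) := by
    simp only [← Complex.normSq_eq_norm_sq, Complex.normSq_apply, Complex.sub_re, Complex.sub_im,
      Complex.mul_re, Complex.mul_im, Complex.conj_re, Complex.conj_im, Complex.one_re,
      Complex.one_im]
    ring
  have hpos : 0 < ‖x - c‖ := by
    rw [norm_pos_iff, sub_ne_zero]
    rintro rfl
    linarith
  have h4 : ‖1 - (starRingEnd ℂ) c * x‖ ≤ ‖x - c‖ := by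
    refine (sq_le_sq₀ (norm_nonneg _) hpos.le).1 ?_
    have hc2 : 0 ≤ 1 - ‖c‖ ^ 2 := by nlinarith [norm_nonneg c]
    have hx2 : 0 ≤ ‖x‖ ^ 2 - 1 := by nlinarith
    nlinarith [mul_nonneg hc2 hx2]
  nlinarith [mul_pos (show 0 < ‖x‖ ^ 2 - 1 by nlinarith) hpos]

/-- If the coordinates of `a` are in the closed disc and their product is unimodular, then `a` is
on the torus. -/
theorem norm_eq_one_of_norm_prod_eq_one {a : Fin 3 → ℂ} (ha : ∀ k, ‖a k‖ ≤ 1)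
    (h : ‖symmetrization 3 a 2‖ = 1) (k : Fin 3) : ‖a k‖ = 1 := by
  rw [symmetrization_three] at h
  have h' : ‖a 0‖ * ‖a 1‖ * ‖a 2‖ = 1 := by simpa using h
  have h0 := ha 0
  have h1 := ha 1
  have h2 := ha 2
  have n0 := norm_nonneg (a 0)
  have n1 := norm_nonneg (a 1)
  have n2 := norm_nonneg (a 2)
  have h01 := mul_le_one₀ h0 n1 h1
  have e2 : ‖a 2‖ = 1 := by nlinarith
  have e1 : ‖a 1‖ = 1 := by rw [e2] at h'; nlinarith
  have e0 : ‖a 0‖ = 1 := by rw [e2, e1] at h'; linarith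
  fin_cases k <;> assumption

end ComplexRoots

/-! ### The image of the torus in bΓ₃, and polynomial convexity of Γ₃. -/

section Geometry

open MvPolynomial

/-- The map `z ↦ (s₁(z)/3, s₂(z)/3, s₃(z))`. -/
noncomputable def symmMean (z : Fin 3 → ℂ) : Fin 3 → ℂ :=
  ![(1 / 3 : ℂ) * (z 0 + z 1 + z 2), (1 / 3 : ℂ) * (z 0 * z 1 + z 1 * z 2 + z 2 * z 0),
    z 0 * z 1 * z 2]

/-- With c = s₁(z)/3 and p = s₃(z), conj z = 1/z gives s₂(z)/3 = p c̄. The cubic with coefficients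
`symmMean z` is thus self-inversive with |c| ≤ 1, and its roots are in the closed disc. Their
product p is unimodular, so they are on the circle. -/
theorem symmMean_mem_symmPolydiscBoundary {z : Fin 3 → ℂ} (hz : ∀ k, ‖z k‖ = 1) :
    symmMean z ∈ symmPolydiscBoundary 3 := by
  obtain ⟨a, ha⟩ := symmetrization_three_surjective (symmMean z)
  have hconj : ∀ k, z k * (starRingEnd ℂ) (z k) = 1 := fun k => by
    rw [Complex.mul_conj, Complex.normSq_eq_norm_sq, hz]; simp
  have hp : ‖z 0 * z 1 * z 2‖ = 1 := by simp [hz]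
  have hc : ‖(1 / 3 : ℂ) * (z 0 + z 1 + z 2)‖ ≤ 1 := by
    rw [norm_mul]
    have := norm_add₃_le (a := z 0) (b := z 1) (c := z 2)
    rw [hz, hz, hz] at this
    norm_num
    linarith
  refine ⟨a, norm_eq_one_of_norm_prod_eq_one (fun k => ?_) ?_, ha⟩
  · refine norm_le_one_of_selfInversive_cubic hp hc ?_
    have h := cubic_symmetrization_eq_zero a k
    rw [ha] at h
    simp only [symmMean, Matrix.cons_val_zero, Matrix.cons_val_one, Matrix.cons_val] at h
    simp only [map_mul, map_add, map_div₀, map_one, map_ofNat]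
    linear_combination h + (1 / 3 : ℂ) * a k * (z 1 * z 2 * hconj 0 + z 0 * z 2 * hconj 1 +
      z 0 * z 1 * hconj 2)
  · rw [ha]
    simpa [symmMean] using hp

theorem symmPolydiscBoundary_subset (n : ℕ) : symmPolydiscBoundary n ⊆ closedSymmPolydisc n :=
  Set.image_mono fun _ hz k => (hz k).le

theorem mem_symmPolydiscBoundary_three {w : Fin 3 → ℂ} (hw : w ∈ closedSymmPolydisc 3)
    (h : ‖w 2‖ = 1) : w ∈ symmPolydiscBoundary 3 := by
  obtain ⟨a, ha, rfl⟩ := hw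
  exact ⟨a, norm_eq_one_of_norm_prod_eq_one ha h, rfl⟩

theorem isCompact_closedSymmPolydisc (n : ℕ) : IsCompact (closedSymmPolydisc n) := by
  have : {z : Fin n → ℂ | ∀ k, ‖z k‖ ≤ 1} = Set.univ.pi fun _ => Metric.closedBall 0 1 := by
    ext z; simp
  rw [closedSymmPolydisc, this]
  exact (isCompact_univ_pi fun _ => isCompact_closedBall _ _).image (continuous_symmetrization n)

/-- `Γ_3` is polynomially convex. -/
theorem exists_separating_polynomial {w : Fin 3 → ℂ} (hw : w ∉ closedSymmPolydisc 3) :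
    ∃ P : MvPolynomial (Fin 3) ℂ, (∀ v ∈ closedSymmPolydisc 3, ‖eval v P‖ ≤ 3) ∧
      3 < ‖eval w P‖ := by
  obtain ⟨a, rfl⟩ := symmetrization_three_surjective w
  -- The functions s_j(z₁^m, z₂^m, z₃^m) are polynomials in s(z) that are bounded by 3 on Γ₃ for all
  -- m. If all were bounded by 3 at s(a) too, the root bound would give |a_k|^m < 6 for every m,
  -- which fails when |a_k| > 1.
  have hpoly : ∀ (m : ℕ) (j : Fin 3), ∃ P : MvPolynomial (Fin 3) ℂ,
      ∀ z, eval (symmetrization 3 z) P = symmetrization 3 (fun k => z k ^ m) j := by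
    intro m j
    have heval : ∀ z : Fin 3 → ℂ, eval z (aeval (fun k => X k ^ m : Fin 3 → MvPolynomial (Fin 3) ℂ)
        (esymm (Fin 3) ℂ (j + 1))) = symmetrization 3 (fun k => z k ^ m) j := fun z => by
      rw [eval_aeval]
      simp only [map_pow, eval_X, eval_esymm]
    obtain ⟨P, hP⟩ := exists_eval_symmetrization_eq (Q := aeval (fun k => X k ^ m)
        (esymm (Fin 3) ℂ (j + 1))) (fun σ z => by
      rw [heval, heval]
      exact congrFun (symmetrization_comp_perm (fun k => z k ^ m) σ) j)
    exact ⟨P, fun z => by rw [hP, heval]⟩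
  choose P hP using hpoly
  by_contra! hcon
  apply hw
  refine ⟨a, fun k => ?_, rfl⟩
  by_contra! hk
  have hbound : ∀ m j, ‖symmetrization 3 (fun k => a k ^ m) j‖ ≤ 3 := by
    intro m j
    rw [← hP]
    refine hcon _ ?_
    rintro _ ⟨z, hz, rfl⟩
    rw [hP]
    refine norm_symmetrization_three_le (fun k => ?_) j
    rw [norm_pow]
    exact pow_le_one₀ (norm_nonneg _) (hz k)
  obtain ⟨m, hm⟩ := pow_unbounded_of_one_lt 6 hk
  have := norm_lt_six_of_cubic_eq_zero (hbound m 0) (hbound m 1) (hbound m 2)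
    (cubic_symmetrization_eq_zero (fun k => a k ^ m) k)
  rw [norm_pow] at this
  linarith

end Geometry

/-! ### Uniform convergence of homogeneous expansions. -/

section HomogeneousExpansion

open Metric

/-- The diagonal of a multilinear form on `ℂⁿ` is a polynomial. -/
theorem exists_mvPolynomial_eval_eq_multilinear {n k : ℕ}
    (p : ContinuousMultilinearMap ℂ (fun _ : Fin k => Fin n → ℂ) ℂ) :
    ∃ Q : MvPolynomial (Fin n) ℂ, ∀ z, MvPolynomial.eval z Q = p fun _ => z := by
  classical
  refine ⟨∑ r : Fin k → Fin n, MvPolynomial.C (p fun j => Pi.single (r j) 1) *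
    ∏ j, MvPolynomial.X (r j), fun z => ?_⟩
  have hz : z = ∑ i, z i • (Pi.single i 1 : Fin n → ℂ) := by
    simpa using pi_eq_sum_univ' z
  have h := p.map_sum fun (_ : Fin k) (i : Fin n) => z i • (Pi.single i 1 : Fin n → ℂ)
  rw [← hz] at h
  rw [h, map_sum]
  refine Finset.sum_congr rfl fun r _ => ?_
  rw [p.map_smul_univ]
  simp [mul_comm]

variable {E : Type*} [NormedAddCommGroup E] [NormedSpace ℂ E]

/-- The homogeneous terms of the power series of `g` at `0` are determined by `g` near `0`. -/
theorem HasFPowerSeriesAt.apply_diag_comp {g : E → ℂ} {p : FormalMultilinearSeries ℂ E ℂ}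
    (hp : HasFPowerSeriesAt g p 0) {q : FormalMultilinearSeries ℂ ℂ ℂ} {z : E}
    (hq : HasFPowerSeriesAt (fun t : ℂ => g (t • z)) q 0) (k : ℕ) :
    p k (fun _ => z) = q k fun _ => 1 := by
  let u : ℂ →L[ℂ] E := ContinuousLinearMap.toSpanSingleton ℂ z
  have hp' : HasFPowerSeriesAt g p (u 0) := by simpa using hp
  have h := hp'.compContinuousLinearMap.eq_formalMultilinearSeries hq
  rw [← h]
  rw [FormalMultilinearSeries.compContinuousLinearMap_apply]
  congr 1
  funext
  simp [u]

theorem norm_cauchyPowerSeries_le_of_forall_norm_le {h : ℂ → ℂ} {R M : ℝ}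
    (hM : ∀ t ∈ sphere (0 : ℂ) |R|, ‖h t‖ ≤ M) (k : ℕ) :
    ‖cauchyPowerSeries h 0 R k‖ ≤ M * |R|⁻¹ ^ k := by
  refine (norm_cauchyPowerSeries_le h 0 R k).trans ?_
  gcongr
  have h1 := intervalIntegral.norm_integral_le_of_norm_le_const (a := 0) (b := 2 * Real.pi)
    (f := fun θ => ‖h (circleMap 0 R θ)‖) (C := M) fun θ _ => by
      rw [norm_norm]
      exact hM _ (circleMap_mem_sphere' 0 R θ)
  rw [sub_zero, abs_of_pos Real.two_pi_pos] at h1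
  rw [inv_mul_le_iff₀ Real.two_pi_pos, mul_comm _ M]
  exact (Real.le_norm_self _).trans h1

/-- The homogeneous expansion of a function that is analytic on a closed ball converges uniformly
on each smaller concentric ball. -/
theorem tendstoUniformlyOn_homogeneous_expansion {g : E → ℂ} {p : FormalMultilinearSeries ℂ E ℂ}
    (hp : HasFPowerSeriesAt g p 0) {ρ r M : ℝ} (hρ : 0 < ρ) (hr : ρ < r)
    (hg : AnalyticOnNhd ℂ g (closedBall 0 r)) (hM : ∀ z ∈ closedBall 0 r, ‖g z‖ ≤ M) :
    TendstoUniformlyOn (fun m z => ∑ k ∈ Finset.range m, p k fun _ => z) g atTop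
      (closedBall 0 ρ) := by
  have hr0 : 0 < r := hρ.trans hr
  -- For |z| ≤ ρ the function t ↦ g(tz) is holomorphic up to |t| = r/ρ > 1. Cauchy's estimate bounds
  -- the k-th term by M (ρ/r)^k, and t = 1 recovers g(z).
  let R : NNReal := ⟨r / ρ, by positivity⟩
  have hR : (R : ℝ) = r / ρ := rfl
  have hR1 : (1 : ℝ) < R := by rw [hR, one_lt_div hρ]; exact hr
  have hR0 : (0 : ℝ) < R := by linarith
  have hmem : ∀ z ∈ closedBall (0 : E) ρ, ∀ t ∈ closedBall (0 : ℂ) R,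
      t • z ∈ closedBall (0 : E) r := by
    intro z hz t ht
    rw [mem_closedBall_zero_iff] at *
    rw [norm_smul]
    calc ‖t‖ * ‖z‖ ≤ r / ρ * ρ := by gcongr; exact ht
      _ = r := by field_simp
  have hser : ∀ z ∈ closedBall (0 : E) ρ,
      HasFPowerSeriesOnBall (fun t : ℂ => g (t • z))
        (cauchyPowerSeries (fun t : ℂ => g (t • z)) 0 R) 0 R := by
    intro z hz
    refine DifferentiableOn.hasFPowerSeriesOnBall (fun t ht => ?_) hR0
    refine DifferentiableAt.differentiableWithinAt ?_
    exact (hg _ (hmem z hz t ht)).differentiableAt.comp t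
      (differentiableAt_id.smul_const z)
  have hcoeff : ∀ z ∈ closedBall (0 : E) ρ, ∀ k, p k (fun _ => z) =
      cauchyPowerSeries (fun t : ℂ => g (t • z)) 0 R k fun _ => 1 := fun z hz k =>
    hp.apply_diag_comp (hser z hz).hasFPowerSeriesAt k
  have hsum : Summable fun k : ℕ => M * |(R : ℝ)|⁻¹ ^ k := by
    refine (summable_geometric_of_lt_one (by positivity) ?_).mul_left M
    rw [abs_of_pos hR0]
    exact inv_lt_one_of_one_lt₀ hR1
  refine (tendstoUniformlyOn_tsum_nat hsum fun k z hz => ?_).congr_right fun z hz => ?_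
  · rw [hcoeff z hz]
    refine ((ContinuousMultilinearMap.le_opNorm _ _).trans ?_).trans
      (norm_cauchyPowerSeries_le_of_forall_norm_le (fun t ht => hM _ (hmem z hz t ?_)) k)
    · simp
    · rw [abs_of_pos hR0] at ht
      exact sphere_subset_closedBall ht
  · have h1 : (1 : ℂ) ∈ eball (0 : ℂ) (R : ENNReal) := by
      rw [Metric.mem_eball, edist_zero_right, enorm_one]
      exact_mod_cast hR1
    have := (hser z hz).hasSum h1
    simp only [zero_add, one_smul] at this
    rw [← this.tsum_eq]
    exact tsum_congr fun k => hcoeff z hz k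

end HomogeneousExpansion

/-! ### Polynomial approximation near Γ₃. -/

section OkaWeil

open Metric MvPolynomial

/-- The set of `s(a)` with all `a_i` in the open disc of radius `ρ` is open. -/
theorem isOpen_forall_cubic_ne_zero (ρ : ℝ) :
    IsOpen {w : Fin 3 → ℂ | ∀ t ∈ closedBall (0 : ℂ) ρ,
      1 - w 0 * t + w 1 * t ^ 2 - w 2 * t ^ 3 ≠ 0} := by
  rw [isOpen_iff_eventually]
  intro w hw
  refine (isCompact_closedBall (0 : ℂ) ρ).eventually_forall_of_forall_eventually fun t ht => ?_
  have hcont : Continuous fun q : (Fin 3 → ℂ) × ℂ =>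
      1 - q.1 0 * q.2 + q.1 1 * q.2 ^ 2 - q.1 2 * q.2 ^ 3 := by fun_prop
  exact hcont.continuousAt.eventually_ne (hw t ht)

theorem reversed_cubic_eq_prod (a : Fin 3 → ℂ) (t : ℂ) :
    1 - symmetrization 3 a 0 * t + symmetrization 3 a 1 * t ^ 2 - symmetrization 3 a 2 * t ^ 3 =
      (1 - a 0 * t) * (1 - a 1 * t) * (1 - a 2 * t) := by
  rw [symmetrization_three]
  simp
  ring

/-- The Oka–Weil theorem for `Γ_3`: a function that is analytic near `Γ_3` is a locally uniform
limit of polynomials near `Γ_3`. -/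
theorem exists_polynomial_tendstoLocallyUniformlyOn {f : (Fin 3 → ℂ) → ℂ}
    (hf : AnalyticOnNhd ℂ f (closedSymmPolydisc 3)) :
    ∃ (U : Set (Fin 3 → ℂ)) (P : ℕ → MvPolynomial (Fin 3) ℂ), IsOpen U ∧
      closedSymmPolydisc 3 ⊆ U ∧
      TendstoLocallyUniformlyOn (fun m w => eval w (P m)) f atTop U := by
  have hball : ∀ {z : Fin 3 → ℂ} {ρ : ℝ}, 0 ≤ ρ → (z ∈ closedBall 0 ρ ↔ ∀ k, ‖z k‖ ≤ ρ) := by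
    intro z ρ hρ
    rw [mem_closedBall_zero_iff, pi_norm_le_iff_of_nonneg hρ]
  have hsan : AnalyticOnNhd ℂ (symmetrization 3) Set.univ := fun z _ =>
    analyticAt_pi_iff.2 fun i => Finset.analyticAt_fun_sum _ fun t _ =>
      Finset.analyticAt_fun_prod _ fun k _ =>
        (ContinuousLinearMap.proj (R := ℂ) (φ := fun _ : Fin 3 => ℂ) k).analyticAt z
  set g : (Fin 3 → ℂ) → ℂ := f ∘ symmetrization 3 with hgdef
  -- In the sup norm balls are polydiscs, so f ∘ s is analytic on a polydisc of radius 1 + δ.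
  obtain ⟨δ, hδ, hsub⟩ := (isCompact_closedBall (0 : Fin 3 → ℂ) 1).exists_cthickening_subset_open
    ((isOpen_analyticAt ℂ f).preimage (continuous_symmetrization 3))
    (fun z hz => hf _ ⟨z, (hball zero_le_one).1 hz, rfl⟩)
  rw [cthickening_closedBall hδ.le zero_le_one] at hsub
  have hg : AnalyticOnNhd ℂ g (closedBall 0 (δ + 1)) := fun z hz =>
    (show AnalyticAt ℂ f (symmetrization 3 z) from hsub hz).comp (hsan z (Set.mem_univ z))
  obtain ⟨M, hM⟩ := (isCompact_closedBall (0 : Fin 3 → ℂ) (δ + 1)).exists_bound_of_continuousOn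
    hg.continuousOn
  obtain ⟨p, hp⟩ := hg 0 (mem_closedBall_self (by linarith))
  have hρ1 : 1 < δ / 2 + 1 := by linarith
  have hρ0 : 0 < δ / 2 + 1 := by linarith
  have hunif := tendstoUniformlyOn_homogeneous_expansion hp hρ0 (by linarith) hg hM
  have hpoly : ∀ k, ∃ P : MvPolynomial (Fin 3) ℂ, ∀ z,
      eval (symmetrization 3 z) P = p k fun _ => z := by
    intro k
    obtain ⟨Q, hQ⟩ := exists_mvPolynomial_eval_eq_multilinear (p k)
    -- The homogeneous terms inherit the symmetry of g, being determined by g along complex lines.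
    obtain ⟨P, hP⟩ := exists_eval_symmetrization_eq (Q := Q) fun σ z => by
      have hline : (fun t : ℂ => g (t • (z ∘ σ))) = fun t : ℂ => g (t • z) := by
        funext t
        have : t • (z ∘ σ) = (t • z) ∘ σ := rfl
        simp only [hgdef, Function.comp_apply, this, symmetrization_comp_perm]
      have han : AnalyticAt ℂ (fun t : ℂ => g (t • z)) 0 := by
        have : AnalyticAt ℂ g ((0 : ℂ) • z) := by rw [zero_smul]; exact ⟨p, hp⟩
        exact this.comp (f := fun t : ℂ => t • z) (by fun_prop)
      obtain ⟨q, hq⟩ := han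
      rw [hQ, hQ, hp.apply_diag_comp hq, hp.apply_diag_comp (hline ▸ hq)]
    exact ⟨P, fun z => by rw [hP, hQ]⟩
  choose P hP using hpoly
  -- The roots of the reversed cubic are the inverses of the nonzero a_k. Having none with |t| ≤ (1
  -- + δ/2)⁻¹ means that all |a_k| < 1 + δ/2, which is inside the polydisc of uniform convergence.
  refine ⟨_, fun m => ∑ k ∈ Finset.range m, P k, isOpen_forall_cubic_ne_zero (δ / 2 + 1)⁻¹, ?_, ?_⟩
  · rintro _ ⟨a, ha, rfl⟩ t ht
    rw [reversed_cubic_eq_prod]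
    have hne : ∀ k, 1 - a k * t ≠ 0 := fun k h => by
      have h1 : ‖a k * t‖ = 1 := by rw [← sub_eq_zero.1 h, norm_one]
      rw [norm_mul] at h1
      have h2 : ‖t‖ < 1 := (mem_closedBall_zero_iff.1 ht).trans_lt (inv_lt_one_of_one_lt₀ hρ1)
      nlinarith [ha k, norm_nonneg (a k), norm_nonneg t]
    exact mul_ne_zero (mul_ne_zero (hne 0) (hne 1)) (hne 2)
  · refine TendstoUniformlyOn.tendstoLocallyUniformlyOn ?_
    rw [Metric.tendstoUniformlyOn_iff] at hunif ⊢
    intro ε hε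
    filter_upwards [hunif ε hε] with m hm w hw
    obtain ⟨a, rfl⟩ := symmetrization_three_surjective w
    have ha : a ∈ closedBall 0 (δ / 2 + 1) := by
      rw [hball hρ0.le]
      intro k
      by_contra! hk
      have hk0 : a k ≠ 0 := fun h => by rw [h, norm_zero] at hk; linarith
      refine hw (a k)⁻¹ ?_ ?_
      · rw [mem_closedBall_zero_iff, norm_inv]
        exact inv_anti₀ hρ0 hk.le
      · rw [reversed_cubic_eq_prod]
        fin_cases k <;> simp_all
    have := hm a ha
    rw [map_sum]
    simp only [hP]
    exact this

end OkaWeil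

/-! ### Extension of an isometry and its commutant to a direct limit. -/

section UnitaryExtension

variable {H : Type u} [NormedAddCommGroup H] [InnerProductSpace ℂ H]

/-- The sequences that are eventually orbits of the isometry `V`; they model the direct limit of
`H → H → H → ⋯` with connecting maps `V`. -/
def eventualOrbits (V : H →ₗᵢ[ℂ] H) : Submodule ℂ (ℕ → H) where
  carrier := {x | ∀ᶠ n in atTop, x (n + 1) = V (x n)}
  zero_mem' := by simp
  add_mem' {x y} hx hy := by
    filter_upwards [hx, hy] with n h1 h2
    simp [h1, h2]
  smul_mem' c x hx := by
    filter_upwards [hx] with n h1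
    simp [h1]

/-- Sequences that are eventually orbits of `V`, with the eventual inner product. -/
def PreUnitaryExtension (V : H →ₗᵢ[ℂ] H) : Type u := eventualOrbits V

namespace PreUnitaryExtension

variable {V : H →ₗᵢ[ℂ] H}

instance : AddCommGroup (PreUnitaryExtension V) := inferInstanceAs (AddCommGroup (eventualOrbits V))
instance : Module ℂ (PreUnitaryExtension V) := inferInstanceAs (Module ℂ (eventualOrbits V))

/-- The terms of the sequence. -/
def term : PreUnitaryExtension V →ₗ[ℂ] (ℕ → H) := (eventualOrbits V).subtype

theorem eventually_term_succ (x : PreUnitaryExtension V) :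
    ∀ᶠ n in atTop, term x (n + 1) = V (term x n) := x.2

/-- The eventual value of the inner products of the terms. -/
noncomputable def innerLim (x y : PreUnitaryExtension V) : ℂ :=
  limUnder atTop fun n => inner ℂ (term x n) (term y n)

/-- Once both sequences are orbits, their inner products are constant because V is isometric. Hence
`limUnder` is a genuine limit and the inner product axioms pass to it. -/
theorem tendsto_inner_term (x y : PreUnitaryExtension V) :
    Tendsto (fun n => inner ℂ (term x n) (term y n)) atTop (𝓝 (innerLim x y)) := by
  refine tendsto_nhds_limUnder ?_
  obtain ⟨N, hN⟩ := eventually_atTop.1 ((eventually_term_succ x).and (eventually_term_succ y))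
  refine ⟨inner ℂ (term x N) (term y N), ?_⟩
  refine tendsto_const_nhds.congr' ?_
  filter_upwards [eventually_ge_atTop N] with n hn
  induction n, hn using Nat.le_induction with
  | base => rfl
  | succ n hn ih => rw [ih, (hN n hn).1, (hN n hn).2, V.inner_map_map]

/-- The pre-inner product on the eventual orbits. -/
noncomputable abbrev core : PreInnerProductSpace.Core ℂ (PreUnitaryExtension V) where
  inner := innerLim
  conj_inner_symm x y := by
    refine tendsto_nhds_unique (((Complex.continuous_conj.tendsto _).comp
      (tendsto_inner_term y x)).congr fun n => ?_) (tendsto_inner_term x y)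
    exact inner_conj_symm _ _
  re_inner_nonneg x := by
    refine ge_of_tendsto' ((Complex.continuous_re.tendsto _).comp (tendsto_inner_term x x))
      fun n => ?_
    exact inner_self_nonneg (𝕜 := ℂ)
  add_left x y z := by
    refine tendsto_nhds_unique (tendsto_inner_term (x + y) z)
      (((tendsto_inner_term x z).add (tendsto_inner_term y z)).congr fun n => ?_)
    rw [map_add, Pi.add_apply, inner_add_left]
  smul_left x y r := by
    refine tendsto_nhds_unique (tendsto_inner_term (r • x) y)
      (((tendsto_inner_term x y).const_mul _).congr fun n => ?_)
    rw [map_smul, Pi.smul_apply, inner_smul_left]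

noncomputable instance : SeminormedAddCommGroup (PreUnitaryExtension V) :=
  InnerProductSpace.Core.toSeminormedAddCommGroup (c := core)
noncomputable instance : InnerProductSpace ℂ (PreUnitaryExtension V) :=
  InnerProductSpace.ofCore core

theorem tendsto_norm_term (x : PreUnitaryExtension V) :
    Tendsto (fun n => ‖term x n‖) atTop (𝓝 ‖x‖) := by
  refine (((Complex.continuous_re.tendsto _).comp (tendsto_inner_term x x)).sqrt).congr fun n => ?_
  exact (norm_eq_sqrt_re_inner (𝕜 := ℂ) (term x n)).symm

/-- The seminorm sees only tails; sequences with the same tail are identified in the completion, as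
in the direct limit. -/
theorem norm_eq_zero_of_eventually {x : PreUnitaryExtension V} (h : ∀ᶠ n in atTop, term x n = 0) :
    ‖x‖ = 0 := by
  refine tendsto_nhds_unique (tendsto_norm_term x) (tendsto_const_nhds.congr' ?_)
  filter_upwards [h] with n hn
  rw [hn, norm_zero]

/-- An operator that commutes with `V` acts on the eventual orbits. -/
noncomputable def map (A : H →L[ℂ] H) (hA : Commute A V.toContinuousLinearMap) :
    PreUnitaryExtension V →L[ℂ] PreUnitaryExtension V :=
  LinearMap.mkContinuous
    { toFun := fun x => ⟨fun n => A (term x n), by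
        filter_upwards [eventually_term_succ x] with n hn
        rw [hn]
        exact congrArg (fun T : H →L[ℂ] H => T (term x n)) hA.eq⟩
      map_add' := fun x y => Subtype.ext <| funext fun n => by
        change A (term (x + y) n) = A (term x n) + A (term y n)
        rw [map_add, Pi.add_apply, map_add]
      map_smul' := fun c x => Subtype.ext <| funext fun n => by
        change A (term (c • x) n) = c • A (term x n)
        rw [map_smul, Pi.smul_apply, map_smul] } ‖A‖
    fun x => le_of_tendsto_of_tendsto' (tendsto_norm_term _) ((tendsto_norm_term x).const_mul ‖A‖)
      fun n => A.le_opNorm (term x n)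

theorem term_map (A : H →L[ℂ] H) (hA : Commute A V.toContinuousLinearMap)
    (x : PreUnitaryExtension V) (n : ℕ) : term (map A hA x) n = A (term x n) := rfl

theorem norm_map_apply (A : H →L[ℂ] H) (hA : Commute A V.toContinuousLinearMap)
    (hnorm : ∀ h, ‖A h‖ = ‖h‖) (x : PreUnitaryExtension V) : ‖map A hA x‖ = ‖x‖ :=
  tendsto_nhds_unique (tendsto_norm_term _)
    ((tendsto_norm_term x).congr fun n => by rw [term_map, hnorm])

variable (V) in
/-- The orbit of a vector. -/
noncomputable def orbit : H →ₗᵢ[ℂ] PreUnitaryExtension V where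
  toFun h := ⟨fun n => (V ^ n) h, .of_forall fun n => by
    change (V ^ (n + 1)) h = V ((V ^ n) h)
    rw [pow_succ']; rfl⟩
  map_add' h k := Subtype.ext <| funext fun n => map_add (V ^ n) h k
  map_smul' c h := Subtype.ext <| funext fun n => map_smul (V ^ n) c h
  norm_map' h := tendsto_nhds_unique (tendsto_norm_term _)
    (tendsto_const_nhds.congr fun n => ((V ^ n).norm_map h).symm)

theorem term_orbit (h : H) (n : ℕ) : term (orbit V h) n = (V ^ n) h := rfl

theorem ext_term {x y : PreUnitaryExtension V} (h : ∀ n, term x n = term y n) : x = y :=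
  Subtype.ext (funext h)

theorem map_orbit (A : H →L[ℂ] H) (hA : Commute A V.toContinuousLinearMap) (h : H) :
    map A hA (orbit V h) = orbit V (A h) := by
  refine ext_term fun n => ?_
  rw [term_map, term_orbit, term_orbit]
  induction n with
  | zero => rfl
  | succ n ih =>
    rw [pow_succ']
    change A (V ((V ^ n) h)) = V ((V ^ n) (A h))
    rw [← ih]
    exact congrArg (fun T : H →L[ℂ] H => T ((V ^ n) h)) hA.eq

/-- Up to a null vector, `V` is surjective on the eventual orbits. -/
theorem exists_norm_map_sub_eq_zero (x : PreUnitaryExtension V) :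
    ∃ y : PreUnitaryExtension V,
      ‖map V.toContinuousLinearMap (Commute.refl _) y - x‖ = 0 := by
  have hx := (tendsto_sub_atTop_nat 1).eventually (eventually_term_succ x)
  refine ⟨⟨fun n => term x (n - 1), ?_⟩, norm_eq_zero_of_eventually ?_⟩
  -- The preimage is x delayed by one step. Truncated subtraction repeats x₀ at the start, which is
  -- harmless as only tails count.
  · change ∀ᶠ n in atTop, term x (n + 1 - 1) = V (term x (n - 1))
    filter_upwards [hx, eventually_ge_atTop 1] with n hn h1
    rw [← hn, Nat.sub_add_cancel h1, Nat.add_sub_cancel]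
  · filter_upwards [hx, eventually_ge_atTop 1] with n hn h1
    rw [map_sub, Pi.sub_apply]
    change V (term x (n - 1)) - term x n = 0
    rw [← hn, Nat.sub_add_cancel h1, sub_self]

end PreUnitaryExtension

/-- A surjective norm-preserving operator is unitary. -/
theorem ContinuousLinearMap.mem_unitary_of_norm_map_of_surjective [CompleteSpace H] {U : H →L[ℂ] H}
    (hU : ∀ x, ‖U x‖ = ‖x‖) (hs : Function.Surjective U) : U ∈ unitary (H →L[ℂ] H) := by
  let e : H ≃ₗᵢ[ℂ] H := LinearIsometryEquiv.ofSurjective ⟨U.toLinearMap, hU⟩ hs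
  exact (Unitary.linearIsometryEquiv.symm e).2

/-- An isometry extends to a unitary, in such a way that its commutant extends multiplicatively,
contractively, and with isometries extending to isometries. -/
theorem exists_unitary_extension (V : H →ₗᵢ[ℂ] H) :
    ∃ (K : Type u) (_ : NormedAddCommGroup K) (_ : InnerProductSpace ℂ K) (_ : CompleteSpace K)
      (ι : H →ₗᵢ[ℂ] K) (E : Submonoid.centralizer {V.toContinuousLinearMap} →* (K →L[ℂ] K)),
      (∀ A h, E A (ι h) = ι (A.1 h)) ∧ (∀ A, ‖E A‖ ≤ ‖A.1‖) ∧
      (∀ A, (∀ h, ‖A.1 h‖ = ‖h‖) → ∀ x, ‖E A x‖ = ‖x‖) ∧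
      ∀ A, A.1 = V.toContinuousLinearMap → E A ∈ unitary (K →L[ℂ] K) := by
  have hcomm : ∀ A : Submonoid.centralizer {V.toContinuousLinearMap},
      Commute A.1 V.toContinuousLinearMap := fun A =>
    (Submonoid.mem_centralizer_iff.1 A.2 _ rfl).symm
  let K := UniformSpace.Completion (PreUnitaryExtension V)
  let E₀ : Submonoid.centralizer {V.toContinuousLinearMap} → (K →L[ℂ] K) := fun A =>
    (PreUnitaryExtension.map A.1 (hcomm A)).completion
  have hE₀ : ∀ A (x : PreUnitaryExtension V), E₀ A (x : K) =
      (PreUnitaryExtension.map A.1 (hcomm A) x : K) := fun A x =>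
    ContinuousLinearMap.completion_apply_coe _ x
  let E : Submonoid.centralizer {V.toContinuousLinearMap} →* (K →L[ℂ] K) :=
    { toFun := E₀
      map_one' := by
        ext x
        induction x using UniformSpace.Completion.induction_on with
        | hp => exact isClosed_eq (by fun_prop) (by fun_prop)
        | ih x => rw [hE₀]; rfl
      map_mul' := fun A B => by
        ext x
        induction x using UniformSpace.Completion.induction_on with
        | hp => exact isClosed_eq (by fun_prop) (by fun_prop)
        | ih x => rw [mul_apply_eq_comp, hE₀, hE₀, hE₀]; rfl }
  have hE : ∀ A (x : PreUnitaryExtension V), E A (x : K) =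
      (PreUnitaryExtension.map A.1 (hcomm A) x : K) := hE₀
  have hiso : ∀ A : Submonoid.centralizer {V.toContinuousLinearMap}, (∀ h, ‖A.1 h‖ = ‖h‖) →
      ∀ x, ‖E A x‖ = ‖x‖ := by
    intro A hA x
    induction x using UniformSpace.Completion.induction_on with
    | hp => exact isClosed_eq (by fun_prop) (by fun_prop)
    | ih x =>
      rw [hE, UniformSpace.Completion.norm_coe, UniformSpace.Completion.norm_coe,
        PreUnitaryExtension.norm_map_apply _ _ hA]
  refine ⟨K, inferInstance, inferInstance, inferInstance,
    UniformSpace.Completion.toComplₗᵢ.comp (PreUnitaryExtension.orbit V), E, fun A h => ?_,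
    fun A => ?_, hiso, ?_⟩
  · change E A ((PreUnitaryExtension.orbit V h : PreUnitaryExtension V) : K) = _
    rw [hE, PreUnitaryExtension.map_orbit]
    rfl
  · refine ContinuousLinearMap.opNorm_le_bound _ (norm_nonneg _) fun x => ?_
    induction x using UniformSpace.Completion.induction_on with
    | hp => exact isClosed_le (by fun_prop) (by fun_prop)
    | ih x =>
      rw [hE, UniformSpace.Completion.norm_coe, UniformSpace.Completion.norm_coe]
      refine (ContinuousLinearMap.le_opNorm _ _).trans ?_
      gcongr
      exact LinearMap.mkContinuous_norm_le _ (norm_nonneg _) _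
  · intro A hA
    have hAiso := hiso A (fun h => by rw [hA]; exact V.norm_map h)
    refine ContinuousLinearMap.mem_unitary_of_norm_map_of_surjective hAiso ?_
    -- The range of an isometry of a complete space is closed, so it suffices to reach the dense
    -- subspace of eventual orbits.
    have hclosed : IsClosed (Set.range (E A)) :=
      (AddMonoidHomClass.isometry_of_norm (E A) hAiso).isClosedEmbedding.isClosed_range
    intro x
    change x ∈ Set.range (E A)
    induction x using UniformSpace.Completion.induction_on with
    | hp => exact hclosed
    | ih x =>
      obtain ⟨y, hy⟩ := PreUnitaryExtension.exists_norm_map_sub_eq_zero x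
      have hmap : PreUnitaryExtension.map A.1 (hcomm A) y =
          PreUnitaryExtension.map V.toContinuousLinearMap (Commute.refl _) y :=
        PreUnitaryExtension.ext_term fun n => by
          rw [PreUnitaryExtension.term_map, PreUnitaryExtension.term_map, hA]
      refine ⟨(y : K), ?_⟩
      rw [hE, hmap, ← sub_eq_zero, ← norm_eq_zero, ← UniformSpace.Completion.coe_sub,
        UniformSpace.Completion.norm_coe, ← hy]

end UnitaryExtension

/-! ### Square summable sequences and coordinatewise unitaries. -/

section SquareSummable

variable {G : Type u} [NormedAddCommGroup G] [InnerProductSpace ℂ G]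

omit [InnerProductSpace ℂ G] in
theorem lp.hasSum_norm_sq (x : lp (fun _ : ℕ => G) 2) : HasSum (fun n => ‖x n‖ ^ 2) (‖x‖ ^ 2) := by
  simpa using lp.hasSum_norm (p := 2) (by norm_num) x

omit [InnerProductSpace ℂ G] in
theorem memℓp_two_of_summable {f : ℕ → G} (hf : Summable fun n => ‖f n‖ ^ 2) : Memℓp f 2 :=
  memℓp_gen (by simpa using hf)

omit [InnerProductSpace ℂ G] in
theorem lp.norm_sq_eq_of_hasSum {x : lp (fun _ : ℕ => G) 2} {c : ℝ}
    (h : HasSum (fun n => ‖x n‖ ^ 2) c) : ‖x‖ ^ 2 = c :=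
  (lp.hasSum_norm_sq x).unique h

/-- The coordinatewise action of a unitary on a space of square summable sequences. -/
noncomputable def lpCongr (W : G ≃ₗᵢ[ℂ] G) :
    lp (fun _ : ℕ => G) 2 ≃ₗᵢ[ℂ] lp (fun _ : ℕ => G) 2 where
  toFun x := ⟨fun n => W (x n), (lp.memℓp x).mono' fun n => (W.norm_map _).le⟩
  invFun x := ⟨fun n => W.symm (x n), (lp.memℓp x).mono' fun n => (W.symm.norm_map _).le⟩
  map_add' x y := by ext n; exact map_add W _ _
  map_smul' c x := by ext n; exact map_smul W _ _
  left_inv x := by ext n; exact W.symm_apply_apply _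
  right_inv x := by ext n; exact W.apply_symm_apply _
  norm_map' x := by
    refine (sq_eq_sq₀ (norm_nonneg _) (norm_nonneg _)).1 (lp.norm_sq_eq_of_hasSum ?_)
    have h := lp.hasSum_norm_sq x
    simp only [← W.norm_map (x _)] at h
    exact h

theorem lpCongr_apply (W : G ≃ₗᵢ[ℂ] G) (x : lp (fun _ : ℕ => G) 2) (n : ℕ) :
    lpCongr W x n = W (x n) := rfl

end SquareSummable

/-! ### The shift by half a pair. -/

section HalfShift

variable {L : Type u} [NormedAddCommGroup L] [InnerProductSpace ℂ L]

/-- Square summable sequences of pairs: the sequence `(a₁, b₁), (a₂, b₂), …` models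
`a₁, b₁, a₂, b₂, …`. -/
abbrev PairSeq (L : Type u) [NormedAddCommGroup L] [InnerProductSpace ℂ L] : Type u :=
  lp (fun _ : ℕ => WithLp 2 (L × L)) 2

/-- The terms of `a, a₁, b₁, a₂, b₂, …`, arranged in pairs. -/
def consTerm (x : WithLp 2 (L × PairSeq L)) : ℕ → WithLp 2 (L × L)
  | 0 => .toLp 2 (x.fst, (x.snd 0).fst)
  | n + 1 => .toLp 2 ((x.snd n).snd, (x.snd (n + 1)).fst)

/-- The new second entries are the old first entries; the new first entries are the added vector
followed by the old second entries. -/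
theorem hasSum_norm_sq_consTerm (x : WithLp 2 (L × PairSeq L)) :
    HasSum (fun n => ‖consTerm x n‖ ^ 2) (‖x‖ ^ 2) := by
  have hsum := lp.hasSum_norm_sq x.snd
  simp only [WithLp.prod_norm_sq_eq_of_L2] at hsum
  have hu : Summable fun n => ‖(x.snd n).fst‖ ^ 2 :=
    hsum.summable.of_nonneg_of_le (fun _ => by positivity) fun n => by
      simp only [le_add_iff_nonneg_right]; positivity
  have hv : Summable fun n => ‖(x.snd n).snd‖ ^ 2 :=
    hsum.summable.of_nonneg_of_le (fun _ => by positivity) fun n => by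
      simp only [le_add_iff_nonneg_left]; positivity
  obtain ⟨s, hs⟩ := hu
  obtain ⟨t, ht⟩ := hv
  have hst : ‖x.snd‖ ^ 2 = s + t := hsum.unique (hs.add ht)
  have hfst : HasSum (fun n => ‖(consTerm x n).fst‖ ^ 2) (‖x.fst‖ ^ 2 + t) :=
    HasSum.zero_add (f := fun n => ‖(consTerm x n).fst‖ ^ 2) ht
  have hsnd : ∀ n, (consTerm x n).snd = (x.snd n).fst := fun n => by cases n <;> rfl
  have h := hfst.add hs
  rw [WithLp.prod_norm_sq_eq_of_L2, hst, add_comm s t, ← add_assoc]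
  simp only [WithLp.prod_norm_sq_eq_of_L2, hsnd]
  exact h

/-- The isometry `(a, (a₁, b₁, a₂, b₂, …)) ↦ a, a₁, b₁, a₂, b₂, …`. -/
noncomputable def consPair : WithLp 2 (L × PairSeq L) →ₗᵢ[ℂ] PairSeq L where
  toFun x := ⟨consTerm x, memℓp_two_of_summable (hasSum_norm_sq_consTerm x).summable⟩
  map_add' x y := by
    ext n : 2
    cases n <;> rfl
  map_smul' c x := by
    ext n : 2
    cases n <;> rfl
  norm_map' x := (sq_eq_sq₀ (norm_nonneg _) (norm_nonneg _)).1
    (lp.norm_sq_eq_of_hasSum (hasSum_norm_sq_consTerm x))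

/-- Changing the first two entries by `W` and all further pairs by `W` agrees with the coordinatewise
action of `W` on the pairs. -/
theorem lpCongr_consPair_consPair (W : WithLp 2 (L × L) ≃ₗᵢ[ℂ] WithLp 2 (L × L)) {a b a' b' : L}
    (hW : W (.toLp 2 (a, b)) = .toLp 2 (a', b')) (m : PairSeq L) :
    lpCongr W (consPair (.toLp 2 (a, consPair (.toLp 2 (b, (lpCongr W).symm m))))) =
      consPair (.toLp 2 (a', consPair (.toLp 2 (b', m)))) := by
  -- Two half shifts make a full shift, with terms (a, b), m₀, m₁, …, which respects the pairing.
  ext n : 2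
  rw [lpCongr_apply]
  rcases n with _ | _ | n
  · exact hW
  · exact W.apply_symm_apply (m 0)
  · exact W.apply_symm_apply (m (n + 1))

-- U acts alike on every entry, so regrouping the entries into other pairs does not affect it.
open LinearIsometryEquiv in
theorem lpCongr_withLpProdCongr_consPair (U : L ≃ₗᵢ[ℂ] L) (a : L) (m : PairSeq L) :
    lpCongr (withLpProdCongr 2 U U) (consPair (.toLp 2 (a, m))) =
      consPair (.toLp 2 (U a, lpCongr (withLpProdCongr 2 U U) m)) := by
  ext n : 2
  rw [lpCongr_apply]
  cases n <;> rfl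

end HalfShift

/-! ### Defect operators and reflections. -/

section Defect

variable {H : Type u} [NormedAddCommGroup H] [InnerProductSpace ℂ H] [CompleteSpace H]

/-- The defect operator of a contraction, with the unitaries that commute with the contraction. -/
theorem exists_defect_operator {T : H →L[ℂ] H} (hT : ‖T‖ ≤ 1) (U : H ≃ₗᵢ[ℂ] H)
    (hU : ∀ h, T (U h) = U (T h)) :
    ∃ D : H →L[ℂ] H, (∀ a b, inner ℂ (D a) (D b) + inner ℂ (T a) (T b) = inner ℂ a b) ∧
      ∀ h, D (U h) = U (D h) := by
  let V : H →L[ℂ] H := U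
  have hV : V ∈ unitary (H →L[ℂ] H) := (Unitary.linearIsometryEquiv.symm U).2
  have hTV : Commute T V := ContinuousLinearMap.ext hU
  have hTsV : Commute (star T) V := by
    have h : Commute T (star V) := Commute.units_inv_right (u := Unitary.toUnits ⟨V, hV⟩) hTV
    rw [← star_star V]
    exact h.star_star
  have hpos : 0 ≤ 1 - star T * T := by
    rw [sub_nonneg]
    exact CStarAlgebra.norm_le_one_iff_of_nonneg _ |>.1 (by
      rw [CStarRing.norm_star_mul_self]; nlinarith [norm_nonneg T])
  have hcomm : Commute (1 - star T * T) V :=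
    (Commute.one_left V).sub_left (hTsV.mul_left hTV)
  refine ⟨CFC.sqrt (1 - star T * T), fun a b => ?_, fun h => ?_⟩
  · have hsa : IsSelfAdjoint (CFC.sqrt (1 - star T * T)) := (CFC.sqrt_nonneg _).isSelfAdjoint
    rw [← ContinuousLinearMap.adjoint_inner_right, ← ContinuousLinearMap.star_eq_adjoint,
      hsa.star_eq, ← mul_apply_eq_comp, CFC.sqrt_mul_sqrt_self _ hpos,
      ← ContinuousLinearMap.adjoint_inner_right T]
    simp [ContinuousLinearMap.star_eq_adjoint, inner_sub_right]
  · have : Commute (CFC.sqrt (1 - star T * T)) V := hcomm.cfcₙ_nnreal _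
    exact congrArg (fun S : H →L[ℂ] H => S h) this.eq

omit [CompleteSpace H] in
/-- A reflection commutes with the unitaries under which the subspace is invariant. -/
theorem Submodule.reflection_comm {E : Submodule ℂ H} [E.HasOrthogonalProjection] (f : H ≃ₗᵢ[ℂ] H)
    (hf : E.map (f.toLinearEquiv : H →ₗ[ℂ] H) = E) (x : H) :
    E.reflection (f x) = f (E.reflection x) := by
  have h := Submodule.reflection_map_apply f E (f x)
  rw [f.symm_apply_apply] at h
  rw [← h]
  congr!
  exact hf.symm

omit [CompleteSpace H] in
/-- If `a + b ∈ E` and `a - b ⊥ E`, then the reflection in `E` maps `a` to `b`. -/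
theorem Submodule.reflection_eq_of_add_mem {E : Submodule ℂ H} [E.HasOrthogonalProjection] {a b : H}
    (h₁ : a + b ∈ E) (h₂ : a - b ∈ Eᗮ) : E.reflection a = b := by
  have ha : a = (2⁻¹ : ℂ) • (a + b) + (2⁻¹ : ℂ) • (a - b) := by module
  rw [ha, map_add, map_smul, map_smul, E.reflection_mem_subspace_eq_self h₁,
    E.reflection_mem_subspace_orthogonalComplement_eq_neg h₂]
  module

end Defect

/-! ### Andô's theorem, equivariant for a unitary. -/

section AndoDilation

open LinearIsometryEquiv (withLpProdCongr withLpProdComm)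

variable {H : Type u} [NormedAddCommGroup H] [InnerProductSpace ℂ H] [CompleteSpace H]

/-- Two commuting contractions that commute with a unitary have defect operators, in a common
space `L`, that are exchanged by a unitary of `L ⊕ L`, compatibly with a unitary of `L`. -/
theorem exists_defect_exchange {T₁ T₂ : H →L[ℂ] H} (h₁₂ : ∀ h, T₁ (T₂ h) = T₂ (T₁ h))
    (hT₁ : ‖T₁‖ ≤ 1) (hT₂ : ‖T₂‖ ≤ 1) (U : H ≃ₗᵢ[ℂ] H) (hU₁ : ∀ h, T₁ (U h) = U (T₁ h))
    (hU₂ : ∀ h, T₂ (U h) = U (T₂ h)) :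
    ∃ (L : Type u) (_ : NormedAddCommGroup L) (_ : InnerProductSpace ℂ L) (_ : CompleteSpace L)
      (D₁ D₂ : H →ₗ[ℂ] L) (UL : L ≃ₗᵢ[ℂ] L) (W : WithLp 2 (L × L) ≃ₗᵢ[ℂ] WithLp 2 (L × L)),
      (∀ h, ‖D₁ h‖ ^ 2 + ‖T₁ h‖ ^ 2 = ‖h‖ ^ 2) ∧ (∀ h, ‖D₂ h‖ ^ 2 + ‖T₂ h‖ ^ 2 = ‖h‖ ^ 2) ∧
      (∀ h, D₁ (U h) = UL (D₁ h)) ∧ (∀ h, D₂ (U h) = UL (D₂ h)) ∧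
      (∀ h, W (.toLp 2 (D₁ (T₂ h), D₂ h)) = .toLp 2 (D₂ (T₁ h), D₁ h)) ∧
      ∀ x, W (withLpProdCongr 2 UL UL x) = withLpProdCongr 2 UL UL (W x) := by
  obtain ⟨d₁, hd₁, hdU₁⟩ := exists_defect_operator hT₁ U hU₁
  obtain ⟨d₂, hd₂, hdU₂⟩ := exists_defect_operator hT₂ U hU₂
  have hnorm : ∀ {T d : H →L[ℂ] H}, (∀ a b, inner ℂ (d a) (d b) + inner ℂ (T a) (T b) =
      inner ℂ a b) → ∀ h, ‖d h‖ ^ 2 + ‖T h‖ ^ 2 = ‖h‖ ^ 2 := fun hd h => by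
    have := hd h h
    simp only [inner_self_eq_norm_sq_to_K] at this
    exact_mod_cast this
  -- Both ‖d₁T₂h‖² + ‖d₂h‖² and ‖d₂T₁h‖² + ‖d₁h‖² equal ‖h‖² - ‖T₁T₂h‖², so the exchange is
  -- isometric where it is prescribed. Doubling the space leaves room to extend it by a reflection,
  -- a canonical choice that commutes with U.
  let L := WithLp 2 (H × H)
  let emb : (H →L[ℂ] H) → (H →ₗ[ℂ] L) := fun d =>
    { toFun := fun h => .toLp 2 (d h, 0)
      map_add' := fun a b => by
        change (.toLp 2 (d (a + b), 0) : L) = .toLp 2 (d a + d b, 0 + 0)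
        rw [map_add, add_zero]
      map_smul' := fun c a => by
        change (.toLp 2 (d (c • a), 0) : L) = .toLp 2 (c • d a, c • 0)
        rw [map_smul, smul_zero] }
  let UL : L ≃ₗᵢ[ℂ] L := withLpProdCongr 2 U U
  let U₄ : WithLp 2 (L × L) ≃ₗᵢ[ℂ] WithLp 2 (L × L) := withLpProdCongr 2 UL UL
  let X : H →L[ℂ] WithLp 2 (L × L) :=
    (WithLp.prodContinuousLinearEquiv 2 ℂ L L).symm.toContinuousLinearMap ∘L
      (((WithLp.prodContinuousLinearEquiv 2 ℂ H H).symm.toContinuousLinearMap ∘L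
        ((d₁ ∘L T₂).prod (d₂ ∘L T₁))).prod
      ((WithLp.prodContinuousLinearEquiv 2 ℂ H H).symm.toContinuousLinearMap ∘L (d₂.prod d₁)))
  have hX : ∀ h, X h = .toLp 2 (.toLp 2 (d₁ (T₂ h), d₂ (T₁ h)), .toLp 2 (d₂ h, d₁ h)) :=
    fun _ => rfl
  let E : Submodule ℂ (WithLp 2 (L × L)) := X.range.topologicalClosure
  have hXU : ∀ h, U₄ (X h) = X (U h) := fun h => by
    simp only [hX, hU₁, hU₂, hdU₁, hdU₂]
    rfl
  have hE : E.map (U₄.toLinearEquiv : WithLp 2 (L × L) →ₗ[ℂ] WithLp 2 (L × L)) = E := by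
    apply SetLike.coe_injective
    change U₄ '' closure (Set.range X) = closure (Set.range X)
    refine (U₄.toHomeomorph.image_closure (Set.range X)).trans (congrArg closure ?_)
    ext y
    constructor
    · rintro ⟨_, ⟨h, rfl⟩, rfl⟩
      exact ⟨U h, (hXU h).symm⟩
    · rintro ⟨h, rfl⟩
      exact ⟨X (U.symm h), ⟨_, rfl⟩, (hXU _).trans (by rw [U.apply_symm_apply])⟩
  let sw : L ≃ₗᵢ[ℂ] L := withLpProdComm 2 ℂ H H
  let sw₂ : WithLp 2 (L × L) ≃ₗᵢ[ℂ] WithLp 2 (L × L) := withLpProdCongr 2 sw sw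
  refine ⟨L, inferInstance, inferInstance, inferInstance, emb d₁, emb d₂, UL,
    E.reflection.trans sw₂, fun h => ?_, fun h => ?_, fun h => ?_, fun h => ?_, fun h => ?_,
    fun x => ?_⟩
  · rw [← hnorm hd₁ h, WithLp.prod_norm_sq_eq_of_L2]
    simp [emb]
  · rw [← hnorm hd₂ h, WithLp.prod_norm_sq_eq_of_L2]
    simp [emb]
  · change WithLp.toLp 2 (d₁ (U h), (0 : H)) = WithLp.toLp 2 (U (d₁ h), U 0)
    rw [hdU₁, map_zero]
  · change WithLp.toLp 2 (d₂ (U h), (0 : H)) = WithLp.toLp 2 (U (d₂ h), U 0)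
    rw [hdU₂, map_zero]
  · let a : WithLp 2 (L × L) := .toLp 2 (.toLp 2 (d₁ (T₂ h), 0), .toLp 2 (d₂ h, 0))
    let b : WithLp 2 (L × L) := .toLp 2 (.toLp 2 (0, d₂ (T₁ h)), .toLp 2 (0, d₁ h))
    have hab : a + b = X h := by
      change (.toLp 2 (.toLp 2 (d₁ (T₂ h) + 0, 0 + d₂ (T₁ h)), .toLp 2 (d₂ h + 0, 0 + d₁ h)) :
        WithLp 2 (L × L)) = _
      rw [hX, add_zero, zero_add, add_zero, zero_add]
    -- The polarized norm identity. The reflection in the closure of the vectors a + b then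
    -- exchanges a and b, and `sw₂` moves b back into the first slots.
    have hsub : a - b ∈ Eᗮ := by
      rw [Submodule.orthogonal_closure, Submodule.mem_orthogonal]
      rintro _ ⟨k, rfl⟩
      change inner ℂ (d₁ (T₂ k)) (d₁ (T₂ h) - 0) + inner ℂ (d₂ (T₁ k)) (0 - d₂ (T₁ h)) +
        (inner ℂ (d₂ k) (d₂ h - 0) + inner ℂ (d₁ k) (0 - d₁ h)) = 0
      simp only [sub_zero, zero_sub, inner_neg_right]
      have e₁ := hd₁ (T₂ k) (T₂ h)
      have e₂ := hd₂ (T₁ k) (T₁ h)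
      have e₃ := hd₁ k h
      have e₄ := hd₂ k h
      rw [h₁₂, h₁₂ h] at e₁
      linear_combination e₁ - e₂ + e₄ - e₃
    have hr : E.reflection a = b := Submodule.reflection_eq_of_add_mem
      (hab ▸ Submodule.le_topologicalClosure _ ⟨h, rfl⟩) hsub
    change sw₂ (E.reflection a) = _
    rw [hr]
    rfl
  · change sw₂ (E.reflection (U₄ x)) = U₄ (sw₂ (E.reflection x))
    rw [Submodule.reflection_comm U₄ hE]
    rfl

/-- Andô's theorem, equivariantly for a unitary `U` that commutes with the contractions: there are
commuting isometries `W₁`, `W₂` and a unitary that commutes with them which compress to the given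
operators; `P` is the compression. -/
theorem exists_isometric_dilation {T₁ T₂ : H →L[ℂ] H} (h₁₂ : ∀ h, T₁ (T₂ h) = T₂ (T₁ h))
    (hT₁ : ‖T₁‖ ≤ 1) (hT₂ : ‖T₂‖ ≤ 1) (U : H ≃ₗᵢ[ℂ] H) (hU₁ : ∀ h, T₁ (U h) = U (T₁ h))
    (hU₂ : ∀ h, T₂ (U h) = U (T₂ h)) :
    ∃ (K : Type u) (_ : NormedAddCommGroup K) (_ : InnerProductSpace ℂ K) (_ : CompleteSpace K)
      (ι : H →ₗᵢ[ℂ] K) (W₁ W₂ : K →ₗᵢ[ℂ] K) (W₃ : K ≃ₗᵢ[ℂ] K),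
      (∀ x, W₁ (W₂ x) = W₂ (W₁ x)) ∧ (∀ x, W₁ (W₃ x) = W₃ (W₁ x)) ∧
      (∀ x, W₂ (W₃ x) = W₃ (W₂ x)) ∧
      (∀ x, ι.toContinuousLinearMap.adjoint (W₁ x) = T₁ (ι.toContinuousLinearMap.adjoint x)) ∧
      (∀ x, ι.toContinuousLinearMap.adjoint (W₂ x) = T₂ (ι.toContinuousLinearMap.adjoint x)) ∧
      ∀ x, ι.toContinuousLinearMap.adjoint (W₃ x) = U (ι.toContinuousLinearMap.adjoint x) := by
  obtain ⟨L, _, _, _, D₁, D₂, UL, W, hD₁, hD₂, hDU₁, hDU₂, hW, hWU⟩ :=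
    exists_defect_exchange h₁₂ hT₁ hT₂ U hU₁ hU₂
  let K := WithLp 2 (H × PairSeq L)
  let ι : H →ₗᵢ[ℂ] K :=
    { toFun := fun h => .toLp 2 (h, 0)
      map_add' := fun a b => by rw [← WithLp.toLp_add, Prod.mk_add_mk, add_zero]
      map_smul' := fun c a => by
        rw [RingHom.id_apply, ← WithLp.toLp_smul, Prod.smul_mk, smul_zero]
      norm_map' := fun h => WithLp.norm_toLp_fst 2 H (PairSeq L) h }
  have hadj : ∀ x, ι.toContinuousLinearMap.adjoint x = x.fst := fun x => by
    refine ext_inner_left ℂ fun h => ?_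
    rw [ContinuousLinearMap.adjoint_inner_right]
    change inner ℂ (WithLp.toLp 2 (h, (0 : PairSeq L))) x = _
    rw [WithLp.prod_inner_apply]
    simp
  let Ŵ := lpCongr W
  let V : ∀ (T : H →L[ℂ] H) (D : H →ₗ[ℂ] L), (∀ h, ‖D h‖ ^ 2 + ‖T h‖ ^ 2 = ‖h‖ ^ 2) →
      (K →ₗᵢ[ℂ] K) := fun T D hD =>
    { toFun := fun x => .toLp 2 (T x.fst, consPair (.toLp 2 (D x.fst, x.snd)))
      map_add' := fun x y => by
        change (.toLp 2 (T (x.fst + y.fst), consPair (.toLp 2 (D (x.fst + y.fst), x.snd + y.snd))) :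
          K) = .toLp 2 (T x.fst + T y.fst, consPair _ + consPair _)
        rw [map_add T, map_add D, ← map_add consPair]
        rfl
      map_smul' := fun c x => by
        change (.toLp 2 (T (c • x.fst), consPair (.toLp 2 (D (c • x.fst), c • x.snd))) : K) =
          .toLp 2 (c • T x.fst, c • consPair _)
        rw [map_smul T, map_smul D, ← map_smul consPair]
        rfl
      norm_map' := fun x => by
        rw [← sq_eq_sq₀ (norm_nonneg _) (norm_nonneg _), WithLp.prod_norm_sq_eq_of_L2]
        simp only [LinearMap.coe_mk, AddHom.coe_mk, WithLp.toLp_fst, WithLp.toLp_snd,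
          LinearIsometry.norm_map, WithLp.prod_norm_sq_eq_of_L2]
        rw [(WithLp.prod_norm_sq_eq_of_L2 x : ‖x‖ ^ 2 = _), ← hD x.fst]
        ring }
  have hV : ∀ T D hD x, V T D hD x = .toLp 2 (T x.fst, consPair (.toLp 2 (D x.fst, x.snd))) :=
    fun _ _ _ _ => rfl
  let Q : K ≃ₗᵢ[ℂ] K := withLpProdCongr 2 (LinearIsometryEquiv.refl ℂ H) Ŵ
  have hQ : ∀ x, Q x = .toLp 2 (x.fst, Ŵ x.snd) := fun _ => rfl
  have hQs : ∀ x, Q.symm x = .toLp 2 (x.fst, Ŵ.symm x.snd) := fun _ => rfl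
  let Û := lpCongr (withLpProdCongr 2 UL UL)
  let W₃ : K ≃ₗᵢ[ℂ] K := withLpProdCongr 2 U Û
  have hW₃ : ∀ x, W₃ x = .toLp 2 (U x.fst, Û x.snd) := fun _ => rfl
  have hWU' : ∀ x, W.symm (withLpProdCongr 2 UL UL x) = withLpProdCongr 2 UL UL (W.symm x) := by
    intro x
    rw [W.symm_apply_eq, hWU, W.apply_symm_apply]
  have hŴU : ∀ m, Ŵ (Û m) = Û (Ŵ m) := fun m => by
    ext n : 2
    exact hWU _
  have hŴU' : ∀ m, Ŵ.symm (Û m) = Û (Ŵ.symm m) := fun m => by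
    ext n : 2
    exact hWU' _
  -- With W₁ = Q V₁ and W₂ = V₂ Q⁻¹, W₂W₁ = V₂V₁ and W₁W₂ = Q V₁V₂ Q⁻¹. V₁V₂ puts the pair (D₁T₂h,
  -- D₂h) in front and V₂V₁ puts (D₂T₁h, D₁h); Q turns the first into the second.
  refine ⟨K, inferInstance, inferInstance, inferInstance, ι,
    Q.toLinearIsometry.comp (V T₁ D₁ hD₁), (V T₂ D₂ hD₂).comp Q.symm.toLinearIsometry, W₃,
    fun x => ?_, fun x => ?_, fun x => ?_, fun x => ?_, fun x => ?_, fun x => ?_⟩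
  · change Q (V T₁ D₁ hD₁ (V T₂ D₂ hD₂ (Q.symm x))) = V T₂ D₂ hD₂ (Q.symm (Q (V T₁ D₁ hD₁ x)))
    rw [Q.symm_apply_apply]
    simp only [hV, hQ, hQs, WithLp.toLp_fst, WithLp.toLp_snd, h₁₂]
    rw [lpCongr_consPair_consPair W (hW x.fst)]
  · change Q (V T₁ D₁ hD₁ (W₃ x)) = W₃ (Q (V T₁ D₁ hD₁ x))
    simp only [hV, hQ, hW₃, WithLp.toLp_fst, WithLp.toLp_snd, hU₁, hDU₁, ← hŴU]
    rw [lpCongr_withLpProdCongr_consPair]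
  · change V T₂ D₂ hD₂ (Q.symm (W₃ x)) = W₃ (V T₂ D₂ hD₂ (Q.symm x))
    simp only [hV, hQs, hW₃, WithLp.toLp_fst, WithLp.toLp_snd, hU₂, hDU₂, hŴU']
    rw [lpCongr_withLpProdCongr_consPair]
  · rw [hadj, hadj]; rfl
  · rw [hadj, hadj]; rfl
  · rw [hadj, hadj]; rfl

end AndoDilation

/-! ### Joint unitary dilation of the triple. -/

section UnitaryDilation

open MvPolynomial

/-- An operator that intertwines two commuting tuples intertwines their polynomial calculi. -/
theorem intertwine_mvPolynomial {n : ℕ} {H K : Type u} [NormedAddCommGroup H]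
    [InnerProductSpace ℂ H] [NormedAddCommGroup K] [InnerProductSpace ℂ K]
    {Φ : MvPolynomial (Fin n) ℂ →ₐ[ℂ] (H →L[ℂ] H)} {Ψ : MvPolynomial (Fin n) ℂ →ₐ[ℂ] (K →L[ℂ] K)}
    {A : H →L[ℂ] K} (h : ∀ i x, Ψ (X i) (A x) = A (Φ (X i) x)) (p : MvPolynomial (Fin n) ℂ)
    (x : H) : Ψ p (A x) = A (Φ p x) := by
  induction p using MvPolynomial.induction_on generalizing x with
  | C a =>
    rw [← MvPolynomial.algebraMap_eq, AlgHom.commutes, AlgHom.commutes,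
      Algebra.algebraMap_eq_smul_one, Algebra.algebraMap_eq_smul_one]
    simp
  | add p q hp hq => simp [hp, hq]
  | mul_X p i hp => rw [map_mul, map_mul, mul_apply_eq_comp, mul_apply_eq_comp, h, hp]

/-- A commuting family one of whose members is an isometry extends to a commuting family in which
that member is unitary. -/
theorem exists_unitary_extension_family {ι : Type*} {H : Type u} [NormedAddCommGroup H]
    [InnerProductSpace ℂ H] [CompleteSpace H] (a : ι → (H →L[ℂ] H))
    (ha : ∀ i j, Commute (a i) (a j)) (k : ι) (hk : ∀ x, ‖a k x‖ = ‖x‖) :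
    ∃ (K : Type u) (_ : NormedAddCommGroup K) (_ : InnerProductSpace ℂ K) (_ : CompleteSpace K)
      (J : H →ₗᵢ[ℂ] K) (b : ι → (K →L[ℂ] K)), (∀ i j, Commute (b i) (b j)) ∧
      (∀ i x, b i (J x) = J (a i x)) ∧ (∀ i, ‖b i‖ ≤ ‖a i‖) ∧
      (∀ i, (∀ x, ‖a i x‖ = ‖x‖) → ∀ x, ‖b i x‖ = ‖x‖) ∧
      (∀ i, a i ∈ unitary (H →L[ℂ] H) → b i ∈ unitary (K →L[ℂ] K)) ∧
      b k ∈ unitary (K →L[ℂ] K) := by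
  let V : H →ₗᵢ[ℂ] H := ⟨(a k).toLinearMap, hk⟩
  have hV : V.toContinuousLinearMap = a k := rfl
  obtain ⟨K, _, _, _, J, E, hJ, hnorm, hiso, hu⟩ := exists_unitary_extension V
  have hmem : ∀ A, Commute A (a k) → A ∈ Submonoid.centralizer {V.toContinuousLinearMap} := by
    rintro A hA _ rfl
    exact hA.eq.symm
  refine ⟨K, inferInstance, inferInstance, inferInstance, J,
    fun i => E ⟨a i, hmem _ (ha i k)⟩, fun i j => ?_, fun i x => hJ _ x, fun i => hnorm _,
    fun i h => hiso _ h, fun i h => ?_, hu _ hV.symm⟩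
  · rw [Commute, SemiconjBy, ← map_mul, ← map_mul]
    exact congrArg E (Subtype.ext (ha i j).eq)
  -- The inverse a_i* also commutes with a_k, so it extends too and inverts the extension of a_i.
  · have hstar : Commute (star (a i)) (a k) :=
      Commute.units_inv_left (u := Unitary.toUnits ⟨a i, h⟩) (ha i k)
    refine ContinuousLinearMap.mem_unitary_of_norm_map_of_surjective
      (hiso _ fun x => ContinuousLinearMap.norm_map_of_mem_unitary h x) fun y =>
        ⟨E ⟨star (a i), hmem _ hstar⟩ y, ?_⟩
    rw [← mul_apply_eq_comp, ← map_mul]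
    have : (⟨a i, hmem _ (ha i k)⟩ * ⟨star (a i), hmem _ hstar⟩ :
        Submonoid.centralizer {V.toContinuousLinearMap}) = 1 :=
      Subtype.ext (Unitary.mem_iff.1 h).2
    rw [this, map_one]
    rfl

variable {H : Type u} [NormedAddCommGroup H] [InnerProductSpace ℂ H] [CompleteSpace H]

/-- Two commuting contractions and a commuting isometry have a joint unitary dilation. -/
theorem exists_unitary_dilation {T : Fin 3 → (H →L[ℂ] H)} (hT : ∀ i j, Commute (T i) (T j))
    (hT₀ : ‖T 0‖ ≤ 1) (hT₁ : ‖T 1‖ ≤ 1) (hT₂ : ∀ x, ‖T 2 x‖ = ‖x‖)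
    {Φ : MvPolynomial (Fin 3) ℂ →ₐ[ℂ] (H →L[ℂ] H)} (hΦ : ∀ i, Φ (X i) = T i) :
    ∃ (K : Type u) (_ : NormedAddCommGroup K) (_ : InnerProductSpace ℂ K) (_ : CompleteSpace K)
      (J : H →ₗᵢ[ℂ] K) (u : Fin 3 → (K →L[ℂ] K)), (∀ i, u i ∈ unitary (K →L[ℂ] K)) ∧
      (∀ i j, Commute (u i) (u j)) ∧
      ∀ Ψ : MvPolynomial (Fin 3) ℂ →ₐ[ℂ] (K →L[ℂ] K), (∀ i, Ψ (X i) = u i) →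
        ∀ p x y, inner ℂ (J y) (Ψ p (J x)) = inner ℂ y (Φ p x) := by
  obtain ⟨K₀, _, _, _, J₀, b, hb, hJ₀, hbnorm, -, -, hb₂⟩ :=
    exists_unitary_extension_family T hT 2 hT₂
  obtain ⟨Φb, hΦb⟩ := exists_mvPolynomial_algHom (R := ℂ) b hb
  have happ : ∀ i j x, b i (b j x) = b j (b i x) := fun i j x =>
    congrArg (fun S : K₀ →L[ℂ] K₀ => S x) (hb i j).eq
  let U := Unitary.linearIsometryEquiv ⟨b 2, hb₂⟩
  obtain ⟨K₁, _, _, _, J₁, W₁, W₂, W₃, h₁₂, h₁₃, h₂₃, hP₁, hP₂, hP₃⟩ :=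
    exists_isometric_dilation (happ 0 1) ((hbnorm 0).trans hT₀) ((hbnorm 1).trans hT₁) U
      (happ 0 2) (happ 1 2)
  let w : Fin 3 → (K₁ →L[ℂ] K₁) :=
    ![W₁.toContinuousLinearMap, W₂.toContinuousLinearMap, W₃.toLinearIsometry.toContinuousLinearMap]
  have hw₁₂ : Commute (w 0) (w 1) := ContinuousLinearMap.ext h₁₂
  have hw₁₃ : Commute (w 0) (w 2) := ContinuousLinearMap.ext h₁₃
  have hw₂₃ : Commute (w 1) (w 2) := ContinuousLinearMap.ext h₂₃
  have hw : ∀ i j, Commute (w i) (w j) := by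
    intro i j
    fin_cases i <;> fin_cases j
    exacts [Commute.refl _, hw₁₂, hw₁₃, hw₁₂.symm, Commute.refl _, hw₂₃, hw₁₃.symm, hw₂₃.symm,
      Commute.refl _]
  have hwu : w 2 ∈ unitary (K₁ →L[ℂ] K₁) := (Unitary.linearIsometryEquiv.symm W₃).2
  have hPw : ∀ i x, J₁.toContinuousLinearMap.adjoint (w i x) =
      b i (J₁.toContinuousLinearMap.adjoint x) := by
    intro i x
    fin_cases i
    exacts [hP₁ x, hP₂ x, hP₃ x]
  obtain ⟨Φw, hΦw⟩ := exists_mvPolynomial_algHom (R := ℂ) w hw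
  -- The first isometry becomes unitary here and the second in the next extension; members that are
  -- already unitary stay unitary.
  obtain ⟨K₂, _, _, _, J₂, c, hc, hJ₂, -, hciso, hcu, hc₀⟩ :=
    exists_unitary_extension_family w hw 0 W₁.norm_map
  obtain ⟨Φc, hΦc⟩ := exists_mvPolynomial_algHom (R := ℂ) c hc
  obtain ⟨K₃, _, _, _, J₃, u, hu, hJ₃, -, -, huu, hu₁⟩ :=
    exists_unitary_extension_family c hc 1 (hciso 1 W₂.norm_map)
  refine ⟨K₃, inferInstance, inferInstance, inferInstance, J₃.comp (J₂.comp (J₁.comp J₀)), u,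
    fun i => ?_, hu, fun Ψ hΨ p x y => ?_⟩
  · fin_cases i
    exacts [huu 0 hc₀, hu₁, huu 2 (hcu 2 hwu)]
  · have e₀ := intertwine_mvPolynomial (A := J₀.toContinuousLinearMap) (Φ := Φ) (Ψ := Φb)
      (fun i x => by rw [hΦ, hΦb]; exact hJ₀ i x) p x
    -- At this stage it is J₁*, not J₁, that intertwines: K₁ lifts the operators instead of
    -- extending them. J₁* J₁ = 1 then yields the compression.
    have e₁ := intertwine_mvPolynomial (A := J₁.toContinuousLinearMap.adjoint) (Φ := Φw) (Ψ := Φb)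
      (fun i x => by rw [hΦw, hΦb]; exact (hPw i x).symm) p (J₁ (J₀ x))
    have e₂ := intertwine_mvPolynomial (A := J₂.toContinuousLinearMap) (Φ := Φw) (Ψ := Φc)
      (fun i x => by rw [hΦw, hΦc]; exact hJ₂ i x) p (J₁ (J₀ x))
    have e₃ := intertwine_mvPolynomial (A := J₃.toContinuousLinearMap) (Φ := Φc) (Ψ := Ψ)
      (fun i x => by rw [hΦc, hΨ]; exact hJ₃ i x) p (J₂ (J₁ (J₀ x)))
    have hJJ : J₁.toContinuousLinearMap.adjoint (J₁ (J₀ x)) = J₀ x :=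
      ext_inner_left ℂ fun v => by
        rw [ContinuousLinearMap.adjoint_inner_right]
        exact J₁.inner_map_map _ _
    simp only [LinearIsometry.coe_toContinuousLinearMap] at e₀ e₂ e₃
    change inner ℂ (J₃ (J₂ (J₁ (J₀ y)))) (Ψ p (J₃ (J₂ (J₁ (J₀ x))))) = _
    rw [e₃, LinearIsometry.inner_map_map, e₂, LinearIsometry.inner_map_map,
      ← LinearIsometry.coe_toContinuousLinearMap J₁, ← ContinuousLinearMap.adjoint_inner_right,
      LinearIsometry.coe_toContinuousLinearMap, ← e₁, hJJ, e₀, LinearIsometry.inner_map_map]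

end UnitaryDilation

/-! ### From contractive polynomial calculus to a spectral set. -/

section SpectralSet

open MvPolynomial

variable {H : Type u} [NormedAddCommGroup H] [InnerProductSpace ℂ H] [CompleteSpace H]

/-- The polynomials, as functions that are holomorphic near `Ω`. -/
theorem aeval_coordNear_apply {n : ℕ} (Ω : Set (Fin n → ℂ)) (p : MvPolynomial (Fin n) ℂ)
    (z : Fin n → ℂ) : (aeval (coordNear Ω) p : (Fin n → ℂ) → ℂ) z = eval z p := by
  induction p using MvPolynomial.induction_on with
  | C a => simp
  | add p q hp hq => simp [hp, hq]
  | mul_X p i hp => simp [hp, coordNear]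

omit [CompleteSpace H] in
/-- A calculus that is continuous for uniform convergence restricts to the polynomial calculus. -/
theorem IsHolomorphicCalculus.apply_aeval {n : ℕ} {Ω : Set (Fin n → ℂ)} {S : Fin n → (H →L[ℂ] H)}
    {ρ : holomorphicNear Ω →ₐ[ℂ] (H →L[ℂ] H)} (hρ : IsHolomorphicCalculus Ω S ρ)
    {Φ : MvPolynomial (Fin n) ℂ →ₐ[ℂ] (H →L[ℂ] H)} (hΦ : ∀ i, Φ (X i) = S i)
    (p : MvPolynomial (Fin n) ℂ) : ρ (aeval (coordNear Ω) p) = Φ p := by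
  have : ρ.comp (aeval (coordNear Ω)) = Φ := algHom_ext fun i => by
    simp [hρ.map_coord, hΦ]
  exact DFunLike.congr_fun this p

/-- If polynomials satisfy von Neumann's inequality on `Γ_3`, the joint spectrum is in `Γ_3`. -/
theorem taylorSpectrum_subset_closedSymmPolydisc {S : Fin 3 → (H →L[ℂ] H)}
    {Φ : MvPolynomial (Fin 3) ℂ →ₐ[ℂ] (H →L[ℂ] H)} (hΦ : ∀ i, Φ (X i) = S i)
    (hnorm : ∀ p : MvPolynomial (Fin 3) ℂ, (∀ v ∈ closedSymmPolydisc 3, ‖eval v p‖ ≤ 3) →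
      ‖Φ p‖ ≤ 3) :
    taylorSpectrum S ⊆ closedSymmPolydisc 3 := by
  intro w hw
  by_contra hcon
  obtain ⟨P, hP, hPw⟩ := exists_separating_polynomial hcon
  exact notMem_taylorSpectrum_of_norm_lt hΦ ((hnorm P hP).trans_lt hPw) hw

variable {Y : Type*} [TopologicalSpace Y] {Ω : Set (Fin 3 → ℂ)}

/-- Composition with a continuous map into `Ω`. -/
noncomputable def pullback (θ : C(Y, Fin 3 → ℂ)) (hθ : ∀ y, θ y ∈ Ω) :
    holomorphicNear Ω →ₐ[ℂ] C(Y, ℂ) where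
  toFun f := ⟨fun y => (f : (Fin 3 → ℂ) → ℂ) (θ y),
    (AnalyticOnNhd.continuousOn f.2).comp_continuous θ.continuous hθ⟩
  map_one' := rfl
  map_mul' _ _ := rfl
  map_zero' := rfl
  map_add' _ _ := rfl
  commutes' _ := rfl

theorem pullback_apply (θ : C(Y, Fin 3 → ℂ)) (hθ : ∀ y, θ y ∈ Ω) (f : holomorphicNear Ω) (y : Y) :
    pullback θ hθ f y = (f : (Fin 3 → ℂ) → ℂ) (θ y) := rfl

variable [CompactSpace Y]

theorem tendsto_pullback (θ : C(Y, Fin 3 → ℂ)) (hθ : ∀ y, θ y ∈ Ω) (hΩ : IsCompact Ω)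
    {U : Set (Fin 3 → ℂ)} (hU : Ω ⊆ U) {F : ℕ → holomorphicNear Ω} {f : holomorphicNear Ω}
    (h : TendstoLocallyUniformlyOn (fun k => (F k : (Fin 3 → ℂ) → ℂ)) f atTop U) :
    Tendsto (fun k => pullback θ hθ (F k)) atTop (𝓝 (pullback θ hθ f)) := by
  have hunif := (tendstoLocallyUniformlyOn_iff_tendstoUniformlyOn_of_compact hΩ).1 (h.mono hU)
  rw [ContinuousMap.tendsto_iff_tendstoUniformly, Metric.tendstoUniformly_iff]
  rw [Metric.tendstoUniformlyOn_iff] at hunif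
  intro ε hε
  filter_upwards [hunif ε hε] with k hk y
  exact hk _ (hθ y)

theorem norm_pullback_le_sSup (θ : C(Y, Fin 3 → ℂ)) (hθ : ∀ y, θ y ∈ Ω) (hΩ : IsCompact Ω)
    (f : holomorphicNear Ω) :
    ‖pullback θ hθ f‖ ≤ sSup ((fun z => ‖(f : (Fin 3 → ℂ) → ℂ) z‖) '' Ω) := by
  rw [ContinuousMap.norm_le _ (Real.sSup_nonneg (by rintro _ ⟨z, -, rfl⟩; exact norm_nonneg _))]
  intro y
  refine le_csSup ?_ ⟨θ y, hθ y, rfl⟩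
  exact (hΩ.image_of_continuousOn (AnalyticOnNhd.continuousOn f.2).norm).bddAbove

omit [CompleteSpace H] in
/-- Every function that is holomorphic near `Γ_3` is approximated by polynomials on a neighbourhood
of `Γ_3`. -/
theorem exists_tendstoLocallyUniformlyOn_aeval (f : holomorphicNear (closedSymmPolydisc 3)) :
    ∃ (U : Set (Fin 3 → ℂ)) (P : ℕ → MvPolynomial (Fin 3) ℂ), IsOpen U ∧
      closedSymmPolydisc 3 ⊆ U ∧ TendstoLocallyUniformlyOn
        (fun k => (aeval (coordNear (closedSymmPolydisc 3)) (P k) : (Fin 3 → ℂ) → ℂ)) f atTop U := by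
  obtain ⟨U, P, hU, hsub, hP⟩ := exists_polynomial_tendstoLocallyUniformlyOn f.2
  refine ⟨U, P, hU, hsub, hP.congr fun k z _ => ?_⟩
  exact (aeval_coordNear_apply _ (P k) z).symm

/-- If the polynomial calculus of `S` factors contractively through restriction to a subset of
`Γ_3`, then `S` is a `Γ_3`-contraction. -/
theorem isGammaContraction_of_contractive {S : Fin 3 → (H →L[ℂ] H)}
    {Φ : MvPolynomial (Fin 3) ℂ →ₐ[ℂ] (H →L[ℂ] H)} (hΦ : ∀ i, Φ (X i) = S i)
    (θ : C(Y, Fin 3 → ℂ)) (hθ : ∀ y, θ y ∈ closedSymmPolydisc 3)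
    (R : C(Y, ℂ) →ₗ[ℂ] (H →L[ℂ] H)) (hR : ∀ g, ‖R g‖ ≤ ‖g‖)
    (hRΦ : ∀ p, R (pullback θ hθ (aeval (coordNear _) p)) = Φ p) :
    IsGammaContraction S := by
  have hΓ := isCompact_closedSymmPolydisc 3
  have hRcont : Continuous R := (R.mkContinuous 1 (by simpa using hR)).continuous
  have hconv : ∀ {U : Set (Fin 3 → ℂ)}, closedSymmPolydisc 3 ⊆ U →
      ∀ {F : ℕ → holomorphicNear (closedSymmPolydisc 3)}
      {f : holomorphicNear (closedSymmPolydisc 3)},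
      TendstoLocallyUniformlyOn (fun k => (F k : (Fin 3 → ℂ) → ℂ)) f atTop U →
      Tendsto (fun k => R (pullback θ hθ (F k))) atTop (𝓝 (R (pullback θ hθ f))) :=
    fun hU _ _ h => (hRcont.tendsto _).comp (tendsto_pullback θ hθ hΓ hU h)
  let ρ : holomorphicNear (closedSymmPolydisc 3) →ₐ[ℂ] (H →L[ℂ] H) :=
    AlgHom.ofLinearMap (R ∘ₗ (pullback θ hθ).toLinearMap)
      (by simpa using hRΦ 1)
      -- R is only linear, but R ∘ `pullback` is multiplicative on polynomials, where it equals Φ;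
      -- approximation carries this over to f and g.
      (fun f g => by
        obtain ⟨U, P, -, hU, hP⟩ := exists_tendstoLocallyUniformlyOn_aeval f
        obtain ⟨V, Q, -, hV, hQ⟩ := exists_tendstoLocallyUniformlyOn_aeval g
        have hPQ := (hRcont.tendsto _).comp
          ((tendsto_pullback θ hθ hΓ hU hP).mul (tendsto_pullback θ hθ hΓ hV hQ))
        refine tendsto_nhds_unique (hPQ.congr fun k => ?_) ((hconv hU hP).mul (hconv hV hQ))
        simp only [Function.comp_apply]
        rw [← map_mul, ← map_mul, hRΦ, hRΦ, hRΦ, map_mul])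
  have hρ : ∀ f, ρ f = R (pullback θ hθ f) := fun _ => rfl
  have hcalc : IsHolomorphicCalculus (closedSymmPolydisc 3) S ρ :=
    { map_coord := fun i => by
        rw [hρ, ← hΦ, ← hRΦ, aeval_X]
      continuous := fun U _ hU F f _ h => hconv hU h }
  have huniq : ∀ ρ', IsHolomorphicCalculus (closedSymmPolydisc 3) S ρ' → ρ' = ρ := by
    intro ρ' hρ'
    ext f : 1
    obtain ⟨U, P, hUo, hU, hP⟩ := exists_tendstoLocallyUniformlyOn_aeval f
    have han : ∀ k, AnalyticOnNhd ℂ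
        (aeval (coordNear (closedSymmPolydisc 3)) (P k) : (Fin 3 → ℂ) → ℂ) U := fun k => by
      rw [funext (aeval_coordNear_apply (closedSymmPolydisc 3) (P k))]
      exact (AnalyticOnNhd.eval_mvPolynomial (P k)).mono (Set.subset_univ _)
    refine tendsto_nhds_unique ((hρ'.continuous U hUo hU _ f han hP).congr fun k => ?_)
      (hconv hU hP)
    rw [hρ'.apply_aeval hΦ, hRΦ]
  refine ⟨fun i j => ?_, taylorSpectrum_subset_closedSymmPolydisc hΦ fun p hp => ?_,
    ⟨ρ, hcalc, huniq⟩, fun ρ' hρ' f => ?_⟩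
  · rw [← hΦ, ← hΦ]
    exact (Commute.all _ _).map Φ
  · rw [← hRΦ]
    refine (hR _).trans ((ContinuousMap.norm_le _ (by norm_num)).2 fun y => ?_)
    rw [pullback_apply, aeval_coordNear_apply]
    exact hp _ (hθ y)
  · rw [huniq ρ' hρ', hρ]
    exact (hR _).trans (norm_pullback_le_sSup θ hθ hΓ f)

end SpectralSet

/-! ### The Γ₃-unitary built from commuting unitaries. -/

section SymmMean

open MvPolynomial

/-- The components of `symmMean`, as polynomials. -/
noncomputable def symmMeanPoly : Fin 3 → MvPolynomial (Fin 3) ℂ :=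
  ![C (1 / 3) * (X 0 + X 1 + X 2), C (1 / 3) * (X 0 * X 1 + X 1 * X 2 + X 2 * X 0),
    X 0 * X 1 * X 2]

theorem eval_symmMeanPoly (z : Fin 3 → ℂ) (i : Fin 3) : eval z (symmMeanPoly i) = symmMean z i := by
  fin_cases i <;> simp [symmMeanPoly, symmMean]

/-- The map `symmMean` on the torus. -/
noncomputable def torusSymmMean : C(Fin 3 → Circle, Fin 3 → ℂ) where
  toFun z := symmMean fun k => (z k : ℂ)
  continuous_toFun := continuous_pi fun i => by
    fin_cases i <;> simp [symmMean] <;> fun_prop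

theorem torusSymmMean_mem_boundary (z : Fin 3 → Circle) :
    torusSymmMean z ∈ symmPolydiscBoundary 3 :=
  symmMean_mem_symmPolydiscBoundary fun k => Circle.norm_coe (z k)

theorem torusSymmMean_mem (z : Fin 3 → Circle) : torusSymmMean z ∈ closedSymmPolydisc 3 :=
  symmPolydiscBoundary_subset 3 (torusSymmMean_mem_boundary z)

theorem aeval_torusCoord_apply {n : ℕ} (p : MvPolynomial (Fin n) ℂ) (z : Fin n → Circle) :
    aeval (torusCoord : Fin n → C(Fin n → Circle, ℂ)) p z = eval (fun k => (z k : ℂ)) p := by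
  induction p using MvPolynomial.induction_on with
  | C a => simp
  | add p q hp hq => simp [hp, hq]
  | mul_X p i hp => simp [hp, torusCoord]

theorem pullback_torusSymmMean_aeval (p : MvPolynomial (Fin 3) ℂ) :
    pullback torusSymmMean torusSymmMean_mem (aeval (coordNear _) p) =
      aeval (torusCoord : Fin 3 → C(Fin 3 → Circle, ℂ)) (aeval symmMeanPoly p) := by
  ext z
  rw [pullback_apply, aeval_coordNear_apply, aeval_torusCoord_apply, eval_aeval]
  simp only [eval_symmMeanPoly]
  rfl

variable {K : Type u} [NormedAddCommGroup K] [InnerProductSpace ℂ K] [CompleteSpace K]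

/-- The functions `symmMean` of a commuting triple of unitaries form a `Γ_3`-unitary. -/
theorem isGammaUnitary_symmMean (π : C(Fin 3 → Circle, ℂ) →⋆ₐ[ℂ] (K →L[ℂ] K)) :
    IsGammaUnitary fun i => π (aeval torusCoord (symmMeanPoly i)) := by
  have hcomm : ∀ f g, Commute (π f) (π g) := fun f g => (Commute.all f g).map π
  refine ⟨fun i j => hcomm _ _, fun i => ⟨?_⟩, fun w hw => ?_⟩
  · rw [← map_star]
    exact hcomm _ _
  · have hΓ : w ∈ closedSymmPolydisc 3 := by
      refine taylorSpectrum_subset_closedSymmPolydisc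
        (Φ := (π : C(Fin 3 → Circle, ℂ) →ₐ[ℂ] (K →L[ℂ] K)).comp
          ((aeval torusCoord).comp (aeval symmMeanPoly))) (fun i => by simp) (fun p hp => ?_) hw
      change ‖π (aeval torusCoord (aeval symmMeanPoly p))‖ ≤ 3
      rw [← pullback_torusSymmMean_aeval]
      refine (NonUnitalStarAlgHom.norm_apply_le π _).trans
        ((ContinuousMap.norm_le _ (by norm_num)).2 fun z => ?_)
      rw [pullback_apply, aeval_coordNear_apply]
      exact hp _ (torusSymmMean_mem z)
    -- Within Γ₃ the boundary is given by |w₂| = 1, and the third operator is unitary.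
    refine mem_symmPolydiscBoundary_three hΓ ?_
    by_contra hne
    refine notMem_taylorSpectrum_of_notMem_spectrum (fun i j => hcomm _ _) (k := 2)
      (fun hspec => hne ?_) hw
    have hu : (aeval torusCoord (symmMeanPoly 2) : C(Fin 3 → Circle, ℂ)) ∈
        unitary C(Fin 3 → Circle, ℂ) := by
      rw [Unitary.mem_iff_star_mul_self]
      ext z
      rw [ContinuousMap.mul_apply, ContinuousMap.star_apply, aeval_torusCoord_apply,
        eval_symmMeanPoly, RCLike.star_def, ← Complex.normSq_eq_conj_mul_self,
        Complex.normSq_eq_norm_sq]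
      have h : ‖symmMean (fun k => (z k : ℂ)) 2‖ = 1 := by simp [symmMean, Circle.norm_coe]
      rw [h]
      simp
    exact mem_sphere_zero_iff_norm.1 (spectrum.subset_circle_of_unitary (Unitary.map_mem π hu) hspec)

end SymmMean

/-! ### Compression to the given triple. -/

section Main

open MvPolynomial

theorem theorem3p3 {H : Type u} [NormedAddCommGroup H] [InnerProductSpace ℂ H] [CompleteSpace H]
    (T₁ T₂ V₃ : H →L[ℂ] H)
    (h₁₂ : Commute T₁ T₂) (h₁₃ : Commute T₁ V₃) (h₂₃ : Commute T₂ V₃)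
    (hT₁ : ‖T₁‖ ≤ 1) (hT₂ : ‖T₂‖ ≤ 1) (hV₃ : Isometry V₃) :
    IsGammaContraction
      ![(1 / 3 : ℂ) • (T₁ + T₂ + V₃), (1 / 3 : ℂ) • (T₁ * T₂ + T₂ * V₃ + V₃ * T₁),
        T₁ * T₂ * V₃] ∧
    HasGammaIsometricDilation
      ![(1 / 3 : ℂ) • (T₁ + T₂ + V₃), (1 / 3 : ℂ) • (T₁ * T₂ + T₂ * V₃ + V₃ * T₁),
        T₁ * T₂ * V₃] := by
  let T : Fin 3 → (H →L[ℂ] H) := ![T₁, T₂, V₃]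
  have hT : ∀ i j, Commute (T i) (T j) := by
    intro i j
    fin_cases i <;> fin_cases j
    exacts [Commute.refl _, h₁₂, h₁₃, h₁₂.symm, Commute.refl _, h₂₃, h₁₃.symm, h₂₃.symm,
      Commute.refl _]
  obtain ⟨Φ, hΦ⟩ := exists_mvPolynomial_algHom (R := ℂ) T hT
  obtain ⟨K, _, _, _, J, u, hu, huc, hdil⟩ := exists_unitary_dilation hT hT₁ hT₂
    (fun x => hV₃.norm_map_of_map_zero (map_zero V₃) x) hΦ
  obtain ⟨π, hπ⟩ := exists_torus_starAlgHom u hu huc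
  let P : (K →L[ℂ] K) →ₗ[ℂ] (H →L[ℂ] H) :=
    { toFun := fun B => J.toContinuousLinearMap.adjoint ∘L B ∘L J.toContinuousLinearMap
      map_add' := fun B C => by ext x; simp
      map_smul' := fun a B => by ext x; simp }
  have hP : ∀ B, ‖P B‖ ≤ ‖B‖ := fun B => by
    have hJ : ‖J.toContinuousLinearMap‖ ≤ 1 := J.norm_toContinuousLinearMap_le
    have hJ' : ‖J.toContinuousLinearMap.adjoint‖ ≤ 1 := by
      rwa [LinearIsometryEquiv.norm_map]
    calc ‖P B‖ ≤ ‖J.toContinuousLinearMap.adjoint‖ * (‖B‖ * ‖J.toContinuousLinearMap‖) :=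
          (ContinuousLinearMap.opNorm_comp_le _ _).trans (by
            gcongr
            exact ContinuousLinearMap.opNorm_comp_le _ _)
      _ ≤ 1 * (‖B‖ * 1) := by gcongr
      _ = ‖B‖ := by ring
  have hPp : ∀ p, P (π (aeval torusCoord p)) = Φ p := fun p => by
    let Ψ : MvPolynomial (Fin 3) ℂ →ₐ[ℂ] (K →L[ℂ] K) :=
      (π : C(Fin 3 → Circle, ℂ) →ₐ[ℂ] (K →L[ℂ] K)).comp (aeval torusCoord)
    have hΨ : ∀ i, Ψ (X i) = u i := fun i => by
      rw [← hπ i, ← aeval_X (R := ℂ) torusCoord i]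
      rfl
    have key := hdil Ψ hΨ p
    refine ContinuousLinearMap.ext fun x => ext_inner_left ℂ fun y => ?_
    refine Eq.trans ?_ (key x y)
    exact ContinuousLinearMap.adjoint_inner_right J.toContinuousLinearMap y (Ψ p (J x))
  have hS : ∀ i, (Φ.comp (aeval symmMeanPoly)) (X i) =
      (![(1 / 3 : ℂ) • (T₁ + T₂ + V₃), (1 / 3 : ℂ) • (T₁ * T₂ + T₂ * V₃ + V₃ * T₁),
        T₁ * T₂ * V₃] : Fin 3 → (H →L[ℂ] H)) i := fun i => by
    have hC : ∀ a : ℂ, Φ (C a) = algebraMap ℂ _ a := fun a => Φ.commutes a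
    fin_cases i <;> simp [symmMeanPoly, hΦ, hC, T, Algebra.smul_def, -map_inv₀]
  -- The dilation is itself a Γ₃-unitary, hence a Γ₃-isometry through the identity embedding.
  refine ⟨isGammaContraction_of_contractive hS torusSymmMean torusSymmMean_mem
    (P ∘ₗ (π : C(Fin 3 → Circle, ℂ) →ₐ[ℂ] (K →L[ℂ] K)).toLinearMap)
    (fun g => (hP _).trans (NonUnitalStarAlgHom.norm_apply_le π g)) (fun p => ?_),
    K, inferInstance, inferInstance, inferInstance,
    fun i => π (aeval torusCoord (symmMeanPoly i)), J,
    ⟨(isGammaUnitary_symmMean π).1, K, inferInstance, inferInstance, inferInstance, _,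
      LinearIsometry.id, isGammaUnitary_symmMean π, fun _ _ => rfl⟩, fun m => ?_⟩
  · rw [pullback_torusSymmMean_aeval]
    exact hPp _
  · rw [opMonomial_eq_map_prod (Φ := (π : C(Fin 3 → Circle, ℂ) →ₐ[ℂ] (K →L[ℂ] K)).comp
        ((aeval torusCoord).comp (aeval symmMeanPoly))) (fun i => by simp),
      opMonomial_eq_map_prod hS]
    exact hPp _

end Main
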